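/- **Theorem (MLE lower bound).** Let $\mathcal X=[-1/2,1/2]$, $\mathcal Y=\{0,1\}$, and identify a function $f:\mathcal X\to[0,1]$ with the conditional density under which $y\mid x\sim\mathrm{Ber}(f(x))$. For $a,b\in[0,1]$ let $$d_{\mathrm H}^2(a,b)=\tfrac12\big[(\sqrt a-\sqrt b)^2+(\sqrt{1-a}-\sqrt{1-b})^2\big].$$ For a class $\mathcal F$ of such (measurable) functions, a maximum likelihood estimate (MLE) on a sample $(x_{1:n},y_{1:n})\in\mathcal X^n\times\mathcal Y^n$ is any $\hat f_n\in\mathcal F$ that maximizes $\sum_{t=1}^n\big[y_t\log f(x_t)+(1-y_t)\log(1-f(x_t))\big]$ over $f\in\mathcal F$. The KL risk at $(f^*,\mu)$ of a map $\hat g_n$ that assigns to each sample of size $n$ a measurable function $\mathcal X\to[0,1]$ is $$R_n(\hat g;f^*,\mu)=\mathbb E_{x_{1:n}\sim\mu^{\otimes n}}\,\mathbb E_{y_{1:n}\sim\bigotimes_t\mathrm{Ber}(f^*(x_t))}\,\mathbb E_{x\sim\mu}\,\mathrm{KL}\big(\mathrm{Ber}(f^*(x))\,\|\,\mathrm{Ber}(\hat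 g_n(x))\big),$$ and the minimax risk of $\mathcal F$ is $\mathcal R_n(\mathcal F)=\inf_{\hat g}\sup_{\mu}\sup_{f^*\in\mathcal F}R_n(\hat g;f^*,\mu)$, where $\hat g$ ranges over all estimators ($\hat g_n(x)\in[0,1]$ jointly measurable in the sample and $x$) and $\mu$ over all Borel probability measures on $\mathcal X$. For every $\gamma\in(0,1/2)$ there exists a convex class $\overline\Gamma_\gamma$ of functions $f:[-1/2,1/2]\to[7/16,9/16]$, each satisfying $|f(x)-f(x')|\le|x-x'|^\gamma$ for all $x,x'$, such that $\overline\Gamma_\gamma$ contains the constant function $1/2$, an MLE over $\overline\Gamma_\gamma$ exists on every sample, and the following hold. 1. If $x_{1:n}\sim\mathrm{Unif}[-1/2,1/2]^{\otimes n}$ and $y_{1:n}\sim\mathrm{Ber}(1/2)^{\otimes n}$ independently for every $n\in\mathbb N$, then for every $\delta>0$ there exists $C>0$ such that $$\liminf_{n\to\infty}\ \mathbb P_{x_{1:n},y_{1:n}}\Big[\,\mathbb E_{x\sim\mathrm{Unif}[-1/2,1/2]}\,d_{\mathrm H}^2\big(1/2,\hat f_n(x)\big)\ \ge\ C\,(n\log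 n)^{-\gamma}\ \text{ for every MLE }\hat f_n\text{ over }\overline\Gamma_\gamma\Big]\ \ge\ 1-\delta$$ (inner probability, should the event not be measurable). 2. The model is well specified, yet the MLE does not achieve the minimax rate: there is $K>0$ with $\mathcal R_n(\overline\Gamma_\gamma)\le K\,n^{-2\gamma/(2\gamma+1)}$ for all $n\ge1$, and for every choice $(\hat f_n)_n$ of MLEs over $\overline\Gamma_\gamma$ and every $M\ge0$, $$R_n\big(\hat f;\,1/2,\,\mathrm{Unif}[-1/2,1/2]\big)>M\,\mathcal R_n(\overline\Gamma_\gamma)\qquad\text{for all sufficiently large }n,$$ where the expectation over the sample is read as a lower integral if the choice is not measurable. -/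

import Mathlib

open MeasureTheory Filter
open scoped ENNReal

noncomputable section

namespace CondDensity

/-- The covariate space `[-1/2, 1/2]`. -/
abbrev Covariate : Type := Set.Icc (-1 / 2 : ℝ) (1 / 2)

/-- The uniform distribution on `[-1/2, 1/2]`: Lebesgue measure (the interval has length one). -/
def unif : Measure Covariate := (volume : Measure ℝ).comap Subtype.val

instance : IsProbabilityMeasure unif := by
  constructor
  rw [unif, comap_subtype_coe_apply measurableSet_Icc]
  simp only [Set.image_univ, Subtype.range_coe_subtype, Set.ofPred_mem_eq, Real.volume_Icc]
  norm_num

/-- The Bernoulli distribution on the response space `Bool` (`true` is the response `1`) with mean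
`a ∈ [0,1]`. Values of `a` outside `[0,1]` are clipped; they do not occur below. -/
def bern (a : ℝ) : Measure Bool :=
  ProbabilityTheory.bernoulliMeasure true false (Set.projIcc 0 1 zero_le_one a)

/-- The density of `Ber(a)` with respect to the counting measure on `{0,1}`. -/
def bernDensity (a : ℝ) (y : Bool) : ℝ := if y then a else 1 - a

/-- Squared Hellinger distance between `Ber(a)` and `Ber(b)`, scaled to take values in `[0,1]`. -/
def hellingerSq (a b : ℝ) : ℝ :=
  (1 / 2) * ∑ y : Bool, (√(bernDensity a y) - √(bernDensity b y)) ^ 2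

/-- Log-likelihood of the conditional density `x ↦ Ber(f x)` on a sample of size `n`. -/
def logLik {n : ℕ} (x : Fin n → Covariate) (y : Fin n → Bool) (f : Covariate → ℝ) : ℝ :=
  ∑ t, Real.log (bernDensity (f (x t)) (y t))

/-- `f` is a maximum likelihood estimate over the class `F` on the sample `(x, y)`. -/
def IsMLE (F : Set (Covariate → ℝ)) {n : ℕ} (x : Fin n → Covariate) (y : Fin n → Bool)
    (f : Covariate → ℝ) : Prop :=
  f ∈ F ∧ ∀ g ∈ F, logLik x y g ≤ logLik x y f

/-- `E_{x ∼ Unif[-1/2,1/2]} d_H²(1/2, f(x))`. -/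
def hellingerLoss (f : Covariate → ℝ) : ℝ := ∫ x, hellingerSq (1 / 2) (f x) ∂unif

/-- The law of `(x_{1:n}, y_{1:n})` with `x_{1:n} ∼ Unif[-1/2,1/2]^{⊗n}` and
`y_{1:n} ∼ Ber(1/2)^{⊗n}` independent. -/
def fairLaw (n : ℕ) : Measure ((Fin n → Covariate) × (Fin n → Bool)) :=
  (Measure.pi fun _ => unif).prod (Measure.pi fun _ => bern (1 / 2))

/-- Inner probability of an event: it equals `P E` if `E` is measurable, and never exceeds `P E`
(Mathlib's `P E` is the outer probability for non-measurable `E`). -/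
def innerProb {Ω : Type*} [MeasurableSpace Ω] (P : Measure Ω) (E : Set Ω) : ℝ≥0∞ := 1 - P Eᶜ

/-- KL loss `E_{x ∼ μ} KL(Ber(f(x)) ‖ Ber(g(x)))` of the estimate `g` when the truth is `f`. -/
def klLoss (μ : Measure Covariate) (f g : Covariate → ℝ) : ℝ≥0∞ :=
  ∫⁻ x, InformationTheory.klDiv (bern (f x)) (bern (g x)) ∂μ

/-- KL risk `E_{x_{1:n} ∼ μ} E_{y_{1:n} ∼ f(x_{1:n})}` of the KL loss of the estimate
`e x_{1:n} y_{1:n}`, when the covariate distribution is `μ` and the true conditional density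
is `f`. -/
def klRisk {n : ℕ} (e : (Fin n → Covariate) → (Fin n → Bool) → Covariate → ℝ)
    (μ : Measure Covariate) (f : Covariate → ℝ) : ℝ≥0∞ :=
  ∫⁻ x, ∫⁻ y, klLoss μ f (e x y) ∂(Measure.pi fun t => bern (f (x t))) ∂(Measure.pi fun _ => μ)

/-- Estimators from samples of size `n`: jointly measurable, with values in the Bernoulli
conditional densities. -/
structure IsEstimator {n : ℕ}
    (e : (Fin n → Covariate) → (Fin n → Bool) → Covariate → ℝ) : Prop where
  mem_Icc : ∀ x y z, e x y z ∈ Set.Icc (0 : ℝ) 1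
  measurable : Measurable
    fun p : ((Fin n → Covariate) × (Fin n → Bool)) × Covariate => e p.1.1 p.1.2 p.2

/-- Minimax KL risk of the class `F`: infimum over estimators of the supremum over all covariate
distributions and all true conditional densities in `F`. -/
def minimaxRisk (F : Set (Covariate → ℝ)) (n : ℕ) : ℝ≥0∞ :=
  ⨅ (e : (Fin n → Covariate) → (Fin n → Bool) → Covariate → ℝ) (_ : IsEstimator e),
    ⨆ (μ : Measure Covariate) (_ : IsProbabilityMeasure μ), ⨆ f ∈ F, klRisk e μ f

end CondDensity

end

noncomputable section

namespace CondDensity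

/-! ### Bernoulli measures -/

lemma bern_eq {a : ℝ} (ha : a ∈ Set.Icc (0 : ℝ) 1) :
    bern a =
      ENNReal.ofReal a • Measure.dirac true + ENNReal.ofReal (1 - a) • Measure.dirac false := by
  rw [bern, ProbabilityTheory.bernoulliMeasure_def, Set.projIcc_of_mem zero_le_one ha]
  have h1 : ((unitInterval.toNNReal ⟨a, ha⟩ : NNReal) : ℝ≥0∞) = ENNReal.ofReal a := by
    rw [ENNReal.ofReal]
    congr 1
    ext
    simp [ha.1]
  have h2 : ((unitInterval.toNNReal (unitInterval.symm ⟨a, ha⟩) : NNReal) : ℝ≥0∞) =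
      ENNReal.ofReal (1 - a) := by
    rw [ENNReal.ofReal]
    congr 1
    ext
    simp [ha.2]
  ext s
  rw [← h1, ← h2]
  rfl

instance (a : ℝ) : IsProbabilityMeasure (bern a) := by
  unfold bern; infer_instance

lemma lintegral_bern {a : ℝ} (ha : a ∈ Set.Icc (0 : ℝ) 1) (φ : Bool → ℝ≥0∞) :
    ∫⁻ y, φ y ∂(bern a) = ENNReal.ofReal a * φ true + ENNReal.ofReal (1 - a) * φ false := by
  simp [bern_eq ha]

lemma integral_bern {a : ℝ} (ha : a ∈ Set.Icc (0 : ℝ) 1) (φ : Bool → ℝ) :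
    ∫ y, φ y ∂(bern a) = a * φ true + (1 - a) * φ false := by
  rw [bern_eq ha, integral_add_measure, integral_smul_measure, integral_smul_measure]
  · simp [ha.1, ha.2]
  · exact (Integrable.of_finite).smul_measure (by simp)
  · exact (Integrable.of_finite).smul_measure (by simp)

/-- The Kullback–Leibler divergence between two Bernoulli measures. -/
lemma klDiv_bern {a b : ℝ} (ha : a ∈ Set.Icc (0 : ℝ) 1) (hb : b ∈ Set.Ioo (0 : ℝ) 1) :
    InformationTheory.klDiv (bern a) (bern b) =
      ENNReal.ofReal (b * InformationTheory.klFun (a / b) +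
        (1 - b) * InformationTheory.klFun ((1 - a) / (1 - b))) := by
  have hb' : b ∈ Set.Icc (0 : ℝ) 1 := ⟨hb.1.le, hb.2.le⟩
  have h1b : 0 < 1 - b := sub_pos.2 hb.2
  set d : Bool → ℝ≥0∞ := fun y => ENNReal.ofReal (bernDensity a y / bernDensity b y) with hd
  have hwd : bern a = (bern b).withDensity d := by
    refine Measure.ext_of_lintegral _ fun φ hφ => ?_
    rw [lintegral_withDensity_eq_lintegral_mul _ (measurable_of_finite d) hφ, lintegral_bern ha,
      lintegral_bern hb']
    simp only [hd, Pi.mul_apply, bernDensity, if_true, Bool.false_eq_true, if_false, ← mul_assoc]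
    rw [← ENNReal.ofReal_mul hb.1.le, ← ENNReal.ofReal_mul h1b.le,
      mul_div_cancel₀ _ hb.1.ne', mul_div_cancel₀ _ h1b.ne']
  have hac : bern a ≪ bern b := hwd ▸ withDensity_absolutelyContinuous _ _
  have hrn : (bern a).rnDeriv (bern b) =ᵐ[bern b] d := by
    conv_lhs => rw [hwd]
    exact Measure.rnDeriv_withDensity _ (measurable_of_finite d)
  rw [InformationTheory.klDiv_eq_lintegral_klFun_of_ac hac]
  have : ∫⁻ y, ENNReal.ofReal (InformationTheory.klFun ((bern a).rnDeriv (bern b) y).toReal) ∂(bern b)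
      = ∫⁻ y, ENNReal.ofReal (InformationTheory.klFun (d y).toReal) ∂(bern b) := by
    refine lintegral_congr_ae ?_
    filter_upwards [hrn] with y hy
    rw [hy]
  have q1 : 0 ≤ a / b := div_nonneg ha.1 hb.1.le
  have q2 : 0 ≤ (1 - a) / (1 - b) := div_nonneg (sub_nonneg.2 ha.2) h1b.le
  rw [this, lintegral_bern hb']
  simp only [hd, bernDensity, if_true, Bool.false_eq_true, if_false]
  rw [ENNReal.toReal_ofReal q1, ENNReal.toReal_ofReal q2, ← ENNReal.ofReal_mul hb.1.le,
    ← ENNReal.ofReal_mul h1b.le, ← ENNReal.ofReal_add]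
  · exact mul_nonneg hb.1.le (InformationTheory.klFun_nonneg q1)
  · exact mul_nonneg h1b.le (InformationTheory.klFun_nonneg q2)

lemma klFun_le_sq {u : ℝ} (hu : 0 ≤ u) : InformationTheory.klFun u ≤ (u - 1) ^ 2 := by
  rcases hu.eq_or_lt with rfl | hu
  · simp [InformationTheory.klFun_zero]
  · rw [InformationTheory.klFun_apply]
    nlinarith [Real.log_le_sub_one_of_pos hu]

lemma klDiv_bern_le {a b : ℝ} (ha : a ∈ Set.Icc (0 : ℝ) 1)
    (hb : b ∈ Set.Icc (7 / 16 : ℝ) (9 / 16)) :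
    InformationTheory.klDiv (bern a) (bern b) ≤ ENNReal.ofReal (5 * (a - b) ^ 2) := by
  obtain ⟨hb1, hb2⟩ := hb
  have hb0 : 0 < b := by linarith
  have h1b : 0 < 1 - b := by linarith
  rw [klDiv_bern ha ⟨hb0, by linarith⟩]
  refine ENNReal.ofReal_le_ofReal ?_
  have h1 := mul_le_mul_of_nonneg_left (klFun_le_sq (div_nonneg ha.1 hb0.le)) hb0.le
  have h2 := mul_le_mul_of_nonneg_left
    (klFun_le_sq (div_nonneg (sub_nonneg.2 ha.2) h1b.le)) h1b.le
  have e : b * (a / b - 1) ^ 2 + (1 - b) * ((1 - a) / (1 - b) - 1) ^ 2 =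
      (a - b) ^ 2 * (1 / (b * (1 - b))) := by
    field_simp
    ring
  have h3 : 1 / (b * (1 - b)) ≤ 5 := by
    rw [div_le_iff₀ (by positivity)]
    nlinarith
  nlinarith [sq_nonneg (a - b)]

lemma le_klDiv_bern_half {b : ℝ} (hb : b ∈ Set.Ioo (0 : ℝ) 1) :
    ENNReal.ofReal (2 * (b - 1 / 2) ^ 2) ≤ InformationTheory.klDiv (bern (1 / 2)) (bern b) := by
  obtain ⟨hb0, hb1⟩ := hb
  have h1b : 0 < 1 - b := by linarith
  rw [klDiv_bern (by constructor <;> norm_num) ⟨hb0, hb1⟩]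
  refine ENNReal.ofReal_le_ofReal ?_
  have e : b * InformationTheory.klFun (1 / 2 / b) +
      (1 - b) * InformationTheory.klFun ((1 - 1 / 2) / (1 - b)) =
      -(1 / 2) * Real.log (4 * b * (1 - b)) := by
    have l1 : Real.log (1 / 2 / b) = - Real.log (2 * b) := by
      rw [← Real.log_inv]; congr 1; field_simp
    have l2 : Real.log ((1 - 1 / 2) / (1 - b)) = - Real.log (2 * (1 - b)) := by
      rw [← Real.log_inv]; congr 1; field_simp; norm_num
    have l3 : Real.log (4 * b * (1 - b)) = Real.log (2 * b) + Real.log (2 * (1 - b)) := by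
      rw [← Real.log_mul (by positivity) (by positivity)]; congr 1; ring
    rw [InformationTheory.klFun_apply, InformationTheory.klFun_apply, l1, l2, l3]
    field_simp
    ring
  rw [e]
  have := Real.log_le_sub_one_of_pos (show 0 < 4 * b * (1 - b) by positivity)
  nlinarith

/-! ### Second moments of sums over product measures -/

lemma integral_sq_sum_pi {ι : Type*} [Fintype ι] {Ω : ι → Type*} [∀ i, MeasurableSpace (Ω i)]
    {μ : (i : ι) → Measure (Ω i)} [∀ i, IsProbabilityMeasure (μ i)]
    {X : (i : ι) → Ω i → ℝ} (hX : ∀ i, MemLp (X i) 2 (μ i)) (h0 : ∀ i, ∫ ω, X i ω ∂(μ i) = 0) :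
    ∫ ω, (∑ i, X i (ω i)) ^ 2 ∂(Measure.pi μ) = ∑ i, ∫ ω, X i ω ^ 2 ∂(μ i) := by
  have hm : ∀ i, MemLp (fun ω : (i : ι) → Ω i => X i (ω i)) 2 (Measure.pi μ) := fun i =>
    (hX i).comp_measurePreserving (measurePreserving_eval μ i)
  have hsum : MemLp (∑ i, fun ω : (i : ι) → Ω i => X i (ω i)) 2 (Measure.pi μ) :=
    memLp_finsetSum' _ fun i _ => hm i
  have hz : ∫ ω, (∑ i, fun ω : (i : ι) → Ω i => X i (ω i)) ω ∂(Measure.pi μ) = 0 := by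
    simp only [Finset.sum_apply]
    rw [integral_finsetSum _ fun i _ => (hm i).integrable (by norm_num)]
    refine Finset.sum_eq_zero fun i _ => ?_
    rw [← h0 i, ← (measurePreserving_eval μ i).map_eq, integral_map]
    · exact (measurable_pi_apply i).aemeasurable
    · rw [(measurePreserving_eval μ i).map_eq]; exact (hX i).1
  have := ProbabilityTheory.variance_sum_pi (μ := μ) hX
  rw [ProbabilityTheory.variance_of_integral_eq_zero hsum.1.aemeasurable hz] at this
  simp only [Finset.sum_apply] at this
  rw [this]
  exact Finset.sum_congr rfl fun i _ =>
    ProbabilityTheory.variance_of_integral_eq_zero (hX i).1.aemeasurable (h0 i)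

/-- The response coded as `1` (for `true`) or `-1`. -/
def sgn (y : Bool) : ℝ := if y then 1 else -1

lemma abs_sgn (y : Bool) : |sgn y| = 1 := by cases y <;> simp [sgn]

lemma sgn_mul_self (y : Bool) : sgn y * sgn y = 1 := by cases y <;> simp [sgn]

lemma half_mem_Icc : (1 / 2 : ℝ) ∈ Set.Icc (0 : ℝ) 1 := by constructor <;> norm_num

lemma integral_sq_sum_sgn {ι : Type*} [Fintype ι] (a : ι → ℝ) :
    ∫ y, (∑ t, a t * sgn (y t)) ^ 2 ∂(Measure.pi fun _ : ι => bern (1 / 2)) = ∑ t, a t ^ 2 := by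
  rw [integral_sq_sum_pi (X := fun t y => a t * sgn y) (fun t => MemLp.of_discrete)]
  · refine Finset.sum_congr rfl fun t _ => ?_
    rw [integral_bern half_mem_Icc]
    simp [sgn]; ring
  · intro t
    rw [integral_bern half_mem_Icc]
    simp [sgn]; ring

lemma integral_sq_sum_bern_sub {ι : Type*} [Fintype ι] (a p : ι → ℝ)
    (hp : ∀ t, p t ∈ Set.Icc (0 : ℝ) 1) :
    ∫ y, (∑ t, a t * (bernDensity 1 (y t) - p t)) ^ 2 ∂(Measure.pi fun t => bern (p t)) =
      ∑ t, a t ^ 2 * (p t * (1 - p t)) := by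
  rw [integral_sq_sum_pi (X := fun t y => a t * (bernDensity 1 y - p t))
    (fun t => MemLp.of_discrete)]
  · refine Finset.sum_congr rfl fun t _ => ?_
    rw [integral_bern (hp t)]
    simp [bernDensity]; ring
  · intro t
    rw [integral_bern (hp t)]
    simp [bernDensity]; ring

/-! ### The class of conditional densities -/

/-- The midpoint of the covariate space. -/
def origin : Covariate := ⟨0, by constructor <;> norm_num⟩

/-- The `γ`-Hölder functions `f` whose excess `f 0 - 1/2` at the origin lies in `[0, 1/32]` and
bounds (up to a factor two) their `γ/2`-Hölder seminorm: oscillation must be paid for by a constant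
offset from `1/2`. -/
def offsetClass (γ : ℝ) : Set (Covariate → ℝ) :=
  {f | (∀ x y, |f x - f y| ≤ |x.1 - y.1| ^ γ) ∧
    (∀ x y, |f x - f y| ≤ 1 / 2 * (f origin - 1 / 2) * |x.1 - y.1| ^ (γ / 2)) ∧
    f origin ∈ Set.Icc (1 / 2 : ℝ) (17 / 32)}

lemma Covariate.abs_sub_le_one (x y : Covariate) : |x.1 - y.1| ≤ 1 := by
  have hx := x.2; have hy := y.2
  simp only [Set.mem_Icc] at hx hy
  rw [abs_le]; constructor <;> linarith

section Class

variable {γ : ℝ} {f : Covariate → ℝ}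

lemma abs_sub_origin_le (hγ : 0 < γ) (hf : f ∈ offsetClass γ) (x : Covariate) :
    |f x - f origin| ≤ 1 / 2 * (f origin - 1 / 2) := by
  refine (hf.2.1 x origin).trans (mul_le_of_le_one_right ?_ ?_)
  · have := hf.2.2.1; linarith
  · exact Real.rpow_le_one (abs_nonneg _) (Covariate.abs_sub_le_one _ _) (by linarith)

lemma excess_ge (hγ : 0 < γ) (hf : f ∈ offsetClass γ) (x : Covariate) :
    1 / 2 * (f origin - 1 / 2) ≤ f x - 1 / 2 := by
  have := (abs_le.1 (abs_sub_origin_le hγ hf x)).1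
  linarith

lemma excess_le (hγ : 0 < γ) (hf : f ∈ offsetClass γ) (x : Covariate) :
    f x - 1 / 2 ≤ 3 / 2 * (f origin - 1 / 2) := by
  have := (abs_le.1 (abs_sub_origin_le hγ hf x)).2
  linarith

lemma mem_Icc_of_mem_offsetClass (hγ : 0 < γ) (hf : f ∈ offsetClass γ) (x : Covariate) :
    f x ∈ Set.Icc (7 / 16 : ℝ) (9 / 16) := by
  have h1 := excess_ge hγ hf x
  have h2 := excess_le hγ hf x
  obtain ⟨h3, h4⟩ := hf.2.2
  constructor <;> linarith

lemma holderWith_of_mem_offsetClass (hγ : 0 < γ) (hf : f ∈ offsetClass γ) :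
    HolderWith 1 γ.toNNReal f := by
  intro x y
  rw [edist_dist, edist_dist, Real.coe_toNNReal _ hγ.le, ENNReal.coe_one, one_mul,
    ENNReal.ofReal_rpow_of_nonneg dist_nonneg hγ.le]
  refine ENNReal.ofReal_le_ofReal ?_
  rw [Real.dist_eq, Subtype.dist_eq, Real.dist_eq]
  exact hf.1 x y

lemma continuous_of_mem_offsetClass (hγ : 0 < γ) (hf : f ∈ offsetClass γ) : Continuous f :=
  (holderWith_of_mem_offsetClass hγ hf).continuous (by simpa using hγ)

lemma half_mem_offsetClass (γ : ℝ) : (fun _ => (1 / 2 : ℝ)) ∈ offsetClass γ := by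
  refine ⟨fun x y => ?_, fun x y => ?_, ?_⟩
  · simpa using Real.rpow_nonneg (abs_nonneg _) _
  · simp
  · constructor <;> norm_num

lemma convex_offsetClass (γ : ℝ) : Convex ℝ (offsetClass γ) := by
  intro f hf g hg a b ha hb hab
  have key : ∀ x y, |(a • f + b • g) x - (a • f + b • g) y| ≤ a * |f x - f y| + b * |g x - g y| := by
    intro x y
    simp only [Pi.add_apply, Pi.smul_apply, smul_eq_mul]
    calc |a * f x + b * g x - (a * f y + b * g y)| = |a * (f x - f y) + b * (g x - g y)| := by
          congr 1; ring
      _ ≤ |a * (f x - f y)| + |b * (g x - g y)| := abs_add_le _ _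
      _ = _ := by rw [abs_mul, abs_mul, abs_of_nonneg ha, abs_of_nonneg hb]
  refine ⟨fun x y => (key x y).trans ?_, fun x y => (key x y).trans ?_, ?_⟩
  · calc a * |f x - f y| + b * |g x - g y|
        ≤ a * |x.1 - y.1| ^ γ + b * |x.1 - y.1| ^ γ :=
          add_le_add (mul_le_mul_of_nonneg_left (hf.1 x y) ha)
            (mul_le_mul_of_nonneg_left (hg.1 x y) hb)
      _ = |x.1 - y.1| ^ γ := by rw [← add_mul, hab, one_mul]
  · refine (add_le_add (mul_le_mul_of_nonneg_left (hf.2.1 x y) ha)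
            (mul_le_mul_of_nonneg_left (hg.2.1 x y) hb)).trans (le_of_eq ?_)
    simp only [Pi.add_apply, Pi.smul_apply, smul_eq_mul]
    linear_combination (-(1 / 4) * |x.1 - y.1| ^ (γ / 2)) * hab
  · exact (convex_Icc (1 / 2 : ℝ) (17 / 32)) hf.2.2 hg.2.2 ha hb hab

lemma isCompact_offsetClass (hγ : 0 < γ) : IsCompact (offsetClass γ) := by
  have hcl : IsClosed (offsetClass γ) := by
    have h1 : IsClosed {f : Covariate → ℝ | ∀ x y, |f x - f y| ≤ |x.1 - y.1| ^ γ} := by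
      simp only [Set.ofPred_forall]
      exact isClosed_iInter fun x => isClosed_iInter fun y =>
        isClosed_le (by fun_prop) continuous_const
    have h2 : IsClosed {f : Covariate → ℝ | ∀ x y,
        |f x - f y| ≤ 1 / 2 * (f origin - 1 / 2) * |x.1 - y.1| ^ (γ / 2)} := by
      simp only [Set.ofPred_forall]
      exact isClosed_iInter fun x => isClosed_iInter fun y =>
        isClosed_le (by fun_prop) (by fun_prop)
    have h3 : IsClosed {f : Covariate → ℝ | f origin ∈ Set.Icc (1 / 2 : ℝ) (17 / 32)} :=
      isClosed_Icc.preimage (continuous_apply origin)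
    exact h1.inter (h2.inter h3)
  refine (isCompact_univ_pi fun _ : Covariate =>
    isCompact_Icc (a := (7 / 16 : ℝ)) (b := 9 / 16)).of_isClosed_subset hcl ?_
  intro f hf x _
  exact mem_Icc_of_mem_offsetClass hγ hf x

lemma bernDensity_eq (a : ℝ) (y : Bool) :
    bernDensity a y = 1 / 2 * (1 + 2 * (sgn y * (a - 1 / 2))) := by
  cases y <;> simp [bernDensity, sgn] <;> ring

lemma bernDensity_pos {a : ℝ} (ha : a ∈ Set.Icc (7 / 16 : ℝ) (9 / 16)) (y : Bool) :
    0 < bernDensity a y := by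
  obtain ⟨h1, h2⟩ := ha
  cases y <;> simp [bernDensity] <;> linarith

lemma exists_isMLE (hγ : 0 < γ) {n : ℕ} (x : Fin n → Covariate) (y : Fin n → Bool) :
    ∃ f, IsMLE (offsetClass γ) x y f := by
  have hc : ContinuousOn (logLik x y) (offsetClass γ) := by
    unfold logLik
    refine continuousOn_finsetSum _ fun t _ => ContinuousOn.log ?_ fun f hf =>
      (bernDensity_pos (mem_Icc_of_mem_offsetClass hγ hf _) _).ne'
    simp only [bernDensity_eq]
    fun_prop
  obtain ⟨f, hf, hmax⟩ :=
    (isCompact_offsetClass hγ).exists_isMaxOn ⟨_, half_mem_offsetClass γ⟩ hc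
  exact ⟨f, hf, fun g hg => hmax hg⟩

/-! ### Losses in terms of the offset -/

lemma sq_sub_div_four_le_sq_sqrt_sub {a b : ℝ} (ha : a ∈ Set.Icc (0 : ℝ) 1)
    (hb : b ∈ Set.Icc (0 : ℝ) 1) : (a - b) ^ 2 / 4 ≤ (√a - √b) ^ 2 := by
  have e : a - b = (√a - √b) * (√a + √b) := by
    nlinarith [Real.sq_sqrt ha.1, Real.sq_sqrt hb.1]
  have h1 : √a ≤ 1 := Real.sqrt_le_one.2 ha.2
  have h2 : √b ≤ 1 := Real.sqrt_le_one.2 hb.2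
  have h3 : (√a + √b) ^ 2 ≤ 4 := by nlinarith [Real.sqrt_nonneg a, Real.sqrt_nonneg b]
  rw [e, mul_pow]
  nlinarith [sq_nonneg (√a - √b)]

lemma le_hellingerSq_half {b : ℝ} (hb : b ∈ Set.Icc (0 : ℝ) 1) :
    (b - 1 / 2) ^ 2 / 4 ≤ hellingerSq (1 / 2) b := by
  have h1 := sq_sub_div_four_le_sq_sqrt_sub half_mem_Icc hb
  have h2 := sq_sub_div_four_le_sq_sqrt_sub (a := 1 - 1 / 2) (b := 1 - b)
    (by constructor <;> norm_num) ⟨by linarith [hb.2], by linarith [hb.1]⟩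
  simp only [hellingerSq, bernDensity, Fintype.sum_bool, if_true, Bool.false_eq_true, if_false]
  nlinarith

lemma sq_offset_le (hγ : 0 < γ) (hf : f ∈ offsetClass γ) (x : Covariate) :
    (f origin - 1 / 2) ^ 2 / 4 ≤ (f x - 1 / 2) ^ 2 := by
  have h1 := excess_ge hγ hf x
  have h2 := hf.2.2.1
  nlinarith

lemma le_hellingerLoss (hγ : 0 < γ) (hf : f ∈ offsetClass γ) :
    (f origin - 1 / 2) ^ 2 / 16 ≤ hellingerLoss f := by
  have hc := continuous_of_mem_offsetClass hγ hf
  have h_int : Integrable (fun x => hellingerSq (1 / 2) (f x)) unif := by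
    refine Continuous.integrable_of_hasCompactSupport ?_ (HasCompactSupport.of_compactSpace _)
    simp only [hellingerSq, bernDensity_eq]
    fun_prop
  have : ∫ _ : Covariate, (f origin - 1 / 2) ^ 2 / 16 ∂unif ≤ hellingerLoss f := by
    refine integral_mono (integrable_const _) h_int fun x => ?_
    have hx := mem_Icc_of_mem_offsetClass hγ hf x
    have := le_hellingerSq_half (b := f x) ⟨by linarith [hx.1], by linarith [hx.2]⟩
    have := sq_offset_le hγ hf x
    simp only
    linarith
  simpa using this

lemma le_klLoss_half (hγ : 0 < γ) (hf : f ∈ offsetClass γ) :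
    ENNReal.ofReal ((f origin - 1 / 2) ^ 2 / 2) ≤ klLoss unif (fun _ => 1 / 2) f := by
  have : ∫⁻ _ : Covariate, ENNReal.ofReal ((f origin - 1 / 2) ^ 2 / 2) ∂unif ≤
      klLoss unif (fun _ => 1 / 2) f := by
    refine lintegral_mono fun x => ?_
    have hx := mem_Icc_of_mem_offsetClass hγ hf x
    refine le_trans (ENNReal.ofReal_le_ofReal ?_)
      (le_klDiv_bern_half (b := f x) ⟨by linarith [hx.1], by linarith [hx.2]⟩)
    have := sq_offset_le hγ hf x
    linarith
  simpa using this

end Class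

/-! ### Dyadic chaining -/

/-- The index of the dyadic cell of length `2⁻ʲ` that contains `x`. -/
def cell (j : ℕ) (x : Covariate) : ℕ := ⌊(x.1 + 1 / 2) * 2 ^ j⌋₊

/-- The left endpoint of the `k`-th dyadic cell of length `2⁻ʲ`. -/
def node (j k : ℕ) : Covariate := Set.projIcc (-1 / 2) (1 / 2) (by norm_num) (k / 2 ^ j - 1 / 2)

lemma Covariate.add_half_nonneg (x : Covariate) : 0 ≤ x.1 + 1 / 2 := by
  have := x.2.1; linarith

lemma measurable_cell (j : ℕ) : Measurable (cell j) :=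
  Nat.measurable_floor.comp (by fun_prop)

lemma cell_lt (j : ℕ) (x : Covariate) : cell j x < 2 ^ j + 1 := by
  rw [Nat.lt_succ_iff]
  refine Nat.floor_le_of_le ?_
  push_cast
  refine mul_le_of_le_one_left (by positivity) ?_
  have := x.2.2; linarith

lemma cell_succ_div_two (j : ℕ) (x : Covariate) : cell (j + 1) x / 2 = cell j x := by
  rw [cell, cell, ← Nat.floor_div_ofNat]
  congr 1
  rw [pow_succ]
  ring

lemma node_cell (j : ℕ) (x : Covariate) :
    (node j (cell j x)).1 ≤ x.1 ∧ x.1 - (1 / 2) ^ j ≤ (node j (cell j x)).1 := by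
  have hp : (0 : ℝ) < 2 ^ j := by positivity
  have h1 : (cell j x : ℝ) ≤ (x.1 + 1 / 2) * 2 ^ j :=
    Nat.floor_le (mul_nonneg x.add_half_nonneg hp.le)
  have h2 : (x.1 + 1 / 2) * 2 ^ j < cell j x + 1 := Nat.lt_floor_add_one _
  have h1' : (cell j x : ℝ) / 2 ^ j ≤ x.1 + 1 / 2 := by rwa [div_le_iff₀ hp]
  have h2' : x.1 + 1 / 2 - (1 / 2) ^ j ≤ (cell j x : ℝ) / 2 ^ j := by
    rw [le_div_iff₀ hp, sub_mul, ← mul_pow]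
    norm_num
    norm_num at h2
    linarith
  have h0 : (0 : ℝ) ≤ (cell j x : ℝ) / 2 ^ j := by positivity
  have hx := x.2.2
  rw [node, Set.projIcc_of_mem _ ⟨by linarith, by linarith⟩]
  constructor <;> simp only <;> linarith

lemma abs_sub_node_le (j : ℕ) (x : Covariate) : |x.1 - (node j (cell j x)).1| ≤ (1 / 2) ^ j := by
  have := node_cell j x
  rw [abs_le]
  constructor <;> [linarith [pow_pos (show (0 : ℝ) < 1 / 2 by norm_num) j]; linarith]

lemma abs_node_succ_sub_node_le (j : ℕ) (x : Covariate) :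
    |(node (j + 1) (cell (j + 1) x)).1 - (node j (cell j x)).1| ≤ (1 / 2) ^ j := by
  have h1 := node_cell j x
  have h2 := node_cell (j + 1) x
  have h3 : (1 / 2 : ℝ) ^ (j + 1) ≤ (1 / 2) ^ j :=
    pow_le_pow_of_le_one (by norm_num) (by norm_num) (Nat.le_succ j)
  rw [abs_le]
  constructor <;> linarith

section Sample

variable {n : ℕ}

/-- The sum of the signs of the responses over the `k`-th cell of level `j`. -/
def cellSum (j k : ℕ) (x : Fin n → Covariate) (y : Fin n → Bool) : ℝ :=
  ∑ t, (if cell j (x t) = k then 1 else 0) * sgn (y t)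

/-- The sum over the cells of level `j` of the absolute sign sums. -/
def absCellSum (j : ℕ) (x : Fin n → Covariate) (y : Fin n → Bool) : ℝ :=
  ∑ k ∈ Finset.range (2 ^ j + 1), |cellSum j k x y|

/-- The weighted sum of the absolute cell sums over the levels up to `J`. -/
def chainSum (γ : ℝ) (J : ℕ) (x : Fin n → Covariate) (y : Fin n → Bool) : ℝ :=
  ∑ j ∈ Finset.range (J + 1), ((1 / 2 : ℝ) ^ j) ^ (γ / 2) * absCellSum j x y

lemma absCellSum_nonneg (j : ℕ) (x : Fin n → Covariate) (y : Fin n → Bool) :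
    0 ≤ absCellSum j x y := Finset.sum_nonneg fun _ _ => abs_nonneg _

lemma chainSum_nonneg (γ : ℝ) (J : ℕ) (x : Fin n → Covariate) (y : Fin n → Bool) :
    0 ≤ chainSum γ J x y :=
  Finset.sum_nonneg fun _ _ => mul_nonneg (by positivity) (absCellSum_nonneg _ _ _)

lemma abs_sum_sgn_mul_cell_le (j : ℕ) (x : Fin n → Covariate) (y : Fin n → Bool) (G : ℕ → ℝ)
    {B : ℝ} (hG : ∀ t, |G (cell j (x t))| ≤ B) :
    |∑ t, sgn (y t) * G (cell j (x t))| ≤ B * absCellSum j x y := by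
  have e : ∑ t, sgn (y t) * G (cell j (x t)) =
      ∑ k ∈ Finset.range (2 ^ j + 1), G k * cellSum j k x y := by
    simp only [cellSum, Finset.mul_sum]
    rw [Finset.sum_comm]
    refine Finset.sum_congr rfl fun t _ => ?_
    rw [Finset.sum_eq_single_of_mem (cell j (x t)) (Finset.mem_range.2 (cell_lt j (x t)))]
    · simp [mul_comm]
    · intro k _ hk
      simp [hk.symm]
  rw [e, absCellSum, Finset.mul_sum]
  refine (Finset.abs_sum_le_sum_abs _ _).trans (Finset.sum_le_sum fun k _ => ?_)
  rw [abs_mul]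
  by_cases h : ∃ t, cell j (x t) = k
  · obtain ⟨t, rfl⟩ := h
    exact mul_le_mul_of_nonneg_right (hG t) (abs_nonneg _)
  · push Not at h
    have : cellSum j k x y = 0 := Finset.sum_eq_zero fun t _ => by simp [h t]
    simp [this]

lemma half_pow_rpow_le {γ : ℝ} (hγ : γ ≤ 1) (j : ℕ) :
    ((1 / 2 : ℝ) ^ j) ^ (γ / 2) ≤ 2 * ((1 / 2 : ℝ) ^ (j + 1)) ^ (γ / 2) := by
  have h : (1 / 2 : ℝ) ^ j = (1 / 2) ^ (j + 1) * 2 := by rw [pow_succ]; ring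
  rw [h, Real.mul_rpow (by positivity) (by norm_num), mul_comm]
  refine mul_le_mul_of_nonneg_right ?_ (by positivity)
  calc (2 : ℝ) ^ (γ / 2) ≤ 2 ^ (1 : ℝ) :=
        Real.rpow_le_rpow_of_exponent_le (by norm_num) (by linarith)
    _ = 2 := Real.rpow_one 2

lemma abs_sum_sgn_mul_node_le {γ β : ℝ} (hγ0 : 0 < γ) (hγ : γ ≤ 1) (hβ : 0 ≤ β)
    {g : Covariate → ℝ} (hb : ∀ x, |g x| ≤ 2 * β)
    (hg : ∀ x y, |g x - g y| ≤ β * |x.1 - y.1| ^ (γ / 2))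
    (J : ℕ) (x : Fin n → Covariate) (y : Fin n → Bool) :
    |∑ t, sgn (y t) * g (node J (cell J (x t)))| ≤ 2 * β * chainSum γ J x y := by
  induction J with
  | zero =>
    have := abs_sum_sgn_mul_cell_le 0 x y (fun k => g (node 0 k)) fun t => hb _
    simpa [chainSum] using this
  | succ J ih =>
    have hstep := abs_sum_sgn_mul_cell_le (J + 1) x y
      (fun k => g (node (J + 1) k) - g (node J (k / 2)))
      (B := 2 * β * ((1 / 2 : ℝ) ^ (J + 1)) ^ (γ / 2)) fun t => by
        simp only [cell_succ_div_two]
        refine (hg _ _).trans ?_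
        calc β * |(node (J + 1) (cell (J + 1) (x t))).1 - (node J (cell J (x t))).1| ^ (γ / 2)
            ≤ β * ((1 / 2 : ℝ) ^ J) ^ (γ / 2) :=
              mul_le_mul_of_nonneg_left (Real.rpow_le_rpow (abs_nonneg _)
                (abs_node_succ_sub_node_le J (x t)) (by linarith)) hβ
          _ ≤ β * (2 * ((1 / 2 : ℝ) ^ (J + 1)) ^ (γ / 2)) :=
              mul_le_mul_of_nonneg_left (half_pow_rpow_le hγ J) hβ
          _ = _ := by ring
    simp only [cell_succ_div_two] at hstep
    have e : ∑ t, sgn (y t) * g (node (J + 1) (cell (J + 1) (x t))) =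
        ∑ t, sgn (y t) * g (node J (cell J (x t))) +
        ∑ t, sgn (y t) *
          (g (node (J + 1) (cell (J + 1) (x t))) - g (node J (cell J (x t)))) := by
      rw [← Finset.sum_add_distrib]
      exact Finset.sum_congr rfl fun t _ => by ring
    rw [e, chainSum, Finset.sum_range_succ, ← chainSum, mul_add, ← mul_assoc (2 * β)]
    exact (abs_add_le _ _).trans (add_le_add ih hstep)

/-- The chaining bound for the correlation of the signs with a Hölder function. -/
lemma sum_sgn_mul_le {γ β : ℝ} (hγ0 : 0 < γ) (hγ : γ ≤ 1) (hβ : 0 ≤ β)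
    {g : Covariate → ℝ} (hb : ∀ x, |g x| ≤ 2 * β)
    (hg : ∀ x y, |g x - g y| ≤ β * |x.1 - y.1| ^ (γ / 2))
    (hg' : ∀ x y, |g x - g y| ≤ |x.1 - y.1| ^ γ)
    (J : ℕ) (x : Fin n → Covariate) (y : Fin n → Bool) :
    ∑ t, sgn (y t) * g (x t) ≤ 2 * β * chainSum γ J x y + n * ((1 / 2 : ℝ) ^ J) ^ γ := by
  have h1 := (le_abs_self _).trans (abs_sum_sgn_mul_node_le hγ0 hγ hβ hb hg J x y)
  have h2 : ∑ t, sgn (y t) * (g (x t) - g (node J (cell J (x t)))) ≤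
      ∑ _t : Fin n, ((1 / 2 : ℝ) ^ J) ^ γ := by
    refine Finset.sum_le_sum fun t _ => (le_abs_self _).trans ?_
    rw [abs_mul, abs_sgn, one_mul]
    exact (hg' _ _).trans (Real.rpow_le_rpow (abs_nonneg _) (abs_sub_node_le J (x t)) hγ0.le)
  simp only [mul_sub, Finset.sum_sub_distrib, Finset.sum_const, Finset.card_univ, Fintype.card_fin,
    nsmul_eq_mul] at h2
  linarith

/-! ### Moments of the cell sums -/

lemma integral_sum_sq_cellSum (j : ℕ) (x : Fin n → Covariate) :
    ∫ y, ∑ k ∈ Finset.range (2 ^ j + 1), cellSum j k x y ^ 2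
      ∂(Measure.pi fun _ : Fin n => bern (1 / 2)) = n := by
  rw [integral_finsetSum _ fun k _ => Integrable.of_finite]
  simp only [cellSum]
  simp_rw [integral_sq_sum_sgn]
  rw [Finset.sum_comm]
  have : ∀ t : Fin n, ∑ k ∈ Finset.range (2 ^ j + 1),
      (if cell j (x t) = k then (1 : ℝ) else 0) ^ 2 = 1 := by
    intro t
    simp [Nat.lt_succ_iff.1 (cell_lt j (x t))]
  rw [Finset.sum_congr rfl fun t _ => this t]
  simp

lemma integral_absCellSum_le (hn : 1 ≤ n) (j : ℕ) (x : Fin n → Covariate) :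
    ∫ y, absCellSum j x y ∂(Measure.pi fun _ : Fin n => bern (1 / 2)) ≤ √(2 * n * 2 ^ j) := by
  have hn0 : (0 : ℝ) < n := by exact_mod_cast hn
  set u : ℝ := √(2 * n * 2 ^ j) with hu
  have hu0 : 0 < u := Real.sqrt_pos.2 (by positivity)
  have hu2 : u * u = 2 * n * 2 ^ j := Real.mul_self_sqrt (by positivity)
  have hpt : ∀ y : Fin n → Bool, absCellSum j x y ≤
      u / (2 * n) * ∑ k ∈ Finset.range (2 ^ j + 1), cellSum j k x y ^ 2 + u / 2 := by
    intro y
    have h1 : ∀ k ∈ Finset.range (2 ^ j + 1), |cellSum j k x y| ≤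
        u / (2 * n) * cellSum j k x y ^ 2 + n / (2 * u) := by
      intro k _
      have : 0 ≤ (u * |cellSum j k x y| - n) ^ 2 / (2 * n * u) := by positivity
      rw [← sq_abs (cellSum j k x y)]
      have e : (u * |cellSum j k x y| - n) ^ 2 / (2 * n * u) =
          u / (2 * n) * |cellSum j k x y| ^ 2 + n / (2 * u) - |cellSum j k x y| := by
        field_simp; ring
      linarith
    refine (Finset.sum_le_sum h1).trans ?_
    rw [Finset.sum_add_distrib, ← Finset.mul_sum]
    simp only [Finset.sum_const, Finset.card_range, nsmul_eq_mul]
    push_cast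
    have h2 : ((2 : ℝ) ^ j + 1) * (n / (2 * u)) ≤ u / 2 := by
      rw [mul_div_assoc', div_le_div_iff₀ (by positivity) (by norm_num)]
      have : (1 : ℝ) ≤ 2 ^ j := one_le_pow₀ (by norm_num)
      nlinarith
    linarith
  calc ∫ y, absCellSum j x y ∂(Measure.pi fun _ : Fin n => bern (1 / 2))
      ≤ ∫ y, (u / (2 * n) * ∑ k ∈ Finset.range (2 ^ j + 1), cellSum j k x y ^ 2 + u / 2)
          ∂(Measure.pi fun _ : Fin n => bern (1 / 2)) :=
        integral_mono Integrable.of_finite Integrable.of_finite hpt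
    _ = u / (2 * n) * n + u / 2 := by
        rw [integral_add Integrable.of_finite Integrable.of_finite, integral_const_mul,
          integral_sum_sq_cellSum]
        simp
    _ = u := by field_simp; norm_num

lemma half_pow_rpow_mul_sqrt (γ : ℝ) (j : ℕ) :
    ((1 / 2 : ℝ) ^ j) ^ (γ / 2) * √(2 ^ j) = ((2 : ℝ) ^ ((1 - γ) / 2)) ^ j := by
  rw [Real.sqrt_eq_rpow, one_div, inv_pow, ← Real.rpow_neg_eq_inv_rpow,
    ← Real.rpow_add (by positivity), ← Real.rpow_natCast 2 j, ← Real.rpow_mul (by norm_num),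
    ← Real.rpow_natCast (_ ^ _) j, ← Real.rpow_mul (by norm_num)]
  congr 1
  ring

/-- The constant in the first moment bound for `chainSum`. -/
def chainConst (γ : ℝ) : ℝ := √2 * (2 ^ ((1 - γ) / 2) / (2 ^ ((1 - γ) / 2) - 1))

lemma one_lt_two_rpow {γ : ℝ} (hγ : γ < 1) : 1 < (2 : ℝ) ^ ((1 - γ) / 2) :=
  Real.one_lt_rpow (by norm_num) (by linarith)

lemma chainConst_pos {γ : ℝ} (hγ : γ < 1) : 0 < chainConst γ := by
  have := one_lt_two_rpow hγ
  unfold chainConst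
  have : 0 < (2 : ℝ) ^ ((1 - γ) / 2) - 1 := by linarith
  positivity

lemma integral_chainSum_le {γ : ℝ} (hγ : γ < 1) (hn : 1 ≤ n) (J : ℕ) (x : Fin n → Covariate) :
    ∫ y, chainSum γ J x y ∂(Measure.pi fun _ : Fin n => bern (1 / 2)) ≤
      chainConst γ * √n * ((2 : ℝ) ^ J) ^ ((1 - γ) / 2) := by
  simp only [chainSum]
  rw [integral_finsetSum _ fun k _ => Integrable.of_finite]
  simp_rw [integral_const_mul]
  set r : ℝ := (2 : ℝ) ^ ((1 - γ) / 2) with hr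
  have hr1 : 1 < r := one_lt_two_rpow hγ
  calc ∑ j ∈ Finset.range (J + 1), ((1 / 2 : ℝ) ^ j) ^ (γ / 2) *
          ∫ y, absCellSum j x y ∂(Measure.pi fun _ : Fin n => bern (1 / 2))
      ≤ ∑ j ∈ Finset.range (J + 1), √2 * √n * r ^ j := by
        refine Finset.sum_le_sum fun j _ => ?_
        refine (mul_le_mul_of_nonneg_left (integral_absCellSum_le hn j x)
          (by positivity)).trans (le_of_eq ?_)
        rw [Real.sqrt_mul (by positivity), Real.sqrt_mul (by norm_num), hr,
          ← half_pow_rpow_mul_sqrt]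
        ring
    _ = √2 * √n * ((r ^ (J + 1) - 1) / (r - 1)) := by
        rw [← Finset.mul_sum, geom_sum_eq hr1.ne']
    _ ≤ √2 * √n * (r ^ (J + 1) / (r - 1)) := by
        have : 0 < r - 1 := by linarith
        gcongr
        linarith
    _ = _ := by
        have e : ((2 : ℝ) ^ J) ^ ((1 - γ) / 2) = r ^ J := by
          rw [hr, ← Real.rpow_natCast, ← Real.rpow_natCast, ← Real.rpow_mul (by norm_num),
            ← Real.rpow_mul (by norm_num), mul_comm]
        rw [e, chainConst, ← hr, pow_succ]
        ring

lemma measurable_chainSum (γ : ℝ) (J : ℕ) :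
    Measurable fun s : (Fin n → Covariate) × (Fin n → Bool) => chainSum γ J s.1 s.2 := by
  have hs : Measurable sgn := measurable_of_finite _
  have hc : ∀ j k : ℕ, ∀ t : Fin n, Measurable fun s : (Fin n → Covariate) × (Fin n → Bool) =>
      if cell j (s.1 t) = k then (1 : ℝ) else 0 := fun j k t =>
    Measurable.ite ((measurable_cell j).comp (by fun_prop) (measurableSet_singleton k))
      measurable_const measurable_const
  simp only [chainSum, absCellSum, cellSum]
  refine Finset.measurable_sum _ fun j _ => Measurable.const_mul
    (Finset.measurable_sum _ fun k _ => ?_) _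
  refine Measurable.abs (Finset.measurable_sum _ fun t _ => (hc j k t).mul ?_)
  exact hs.comp (by fun_prop)

/-- Markov's inequality, with the first moment computed conditionally on the covariates. -/
lemma fairLaw_ge_le {h : (Fin n → Covariate) × (Fin n → Bool) → ℝ} (hm : Measurable h)
    (h0 : ∀ s, 0 ≤ h s) {B c ε : ℝ} (hc : 0 < c) (hBc : B ≤ ε * c)
    (hB : ∀ x, ∫ y, h (x, y) ∂(Measure.pi fun _ : Fin n => bern (1 / 2)) ≤ B) :
    fairLaw n {s | c ≤ h s} ≤ ENNReal.ofReal ε := by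
  have h1 : ∫⁻ s, ENNReal.ofReal (h s) ∂(fairLaw n) ≤ ENNReal.ofReal B := by
    rw [fairLaw, lintegral_prod _ hm.ennreal_ofReal.aemeasurable]
    calc _ ≤ ∫⁻ _x : Fin n → Covariate, ENNReal.ofReal B ∂(Measure.pi fun _ => unif) := by
          refine lintegral_mono fun x => ?_
          rw [← ofReal_integral_eq_lintegral_ofReal Integrable.of_finite
            (Eventually.of_forall fun y => h0 _)]
          exact ENNReal.ofReal_le_ofReal (hB x)
      _ = ENNReal.ofReal B := by simp
  have h2 : {s | c ≤ h s} = {s | ENNReal.ofReal c ≤ ENNReal.ofReal (h s)} := by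
    ext s
    exact (ENNReal.ofReal_le_ofReal_iff (h0 s)).symm
  rw [h2]
  refine (meas_ge_le_lintegral_div hm.ennreal_ofReal.aemeasurable
    (by simpa using hc) ENNReal.ofReal_ne_top).trans ?_
  rw [ENNReal.div_le_iff (by simpa using hc) ENNReal.ofReal_ne_top,
    ← ENNReal.ofReal_mul' hc.le]
  exact h1.trans (ENNReal.ofReal_le_ofReal hBc)

/-! ### Isolated covariates -/

/-- The number of ordered pairs of distinct indices whose covariates are less than `r` apart. -/
def closePairs (r : ℝ) (x : Fin n → Covariate) : ℝ :=
  ∑ t, ∑ s, if s ≠ t ∧ |(x s).1 - (x t).1| < r then 1 else 0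

/-- The indices whose covariate has distance at least `r` from all the others. -/
def isolated (r : ℝ) (x : Fin n → Covariate) : Finset (Fin n) :=
  Finset.univ.filter fun t => ∀ s, s ≠ t → r ≤ |(x s).1 - (x t).1|

lemma sub_closePairs_le_card_isolated (r : ℝ) (x : Fin n → Covariate) :
    n - closePairs r x ≤ (isolated r x).card := by
  have h : ∀ t : Fin n, (1 : ℝ) - ∑ s, (if s ≠ t ∧ |(x s).1 - (x t).1| < r then (1 : ℝ) else 0) ≤
      if t ∈ isolated r x then 1 else 0 := by
    intro t
    have hnn : ∀ s ∈ Finset.univ,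
        (0 : ℝ) ≤ if s ≠ t ∧ |(x s).1 - (x t).1| < r then (1 : ℝ) else 0 :=
      fun s _ => by split_ifs <;> norm_num
    split_ifs with ht
    · linarith [Finset.sum_nonneg hnn]
    · simp only [isolated, Finset.mem_filter, Finset.mem_univ, true_and, not_forall, not_le] at ht
      obtain ⟨s, hs, hst⟩ := ht
      have := Finset.single_le_sum hnn (Finset.mem_univ s)
      rw [if_pos ⟨hs, hst⟩] at this
      linarith
  have := Finset.sum_le_sum fun t (_ : t ∈ Finset.univ) => h t
  simpa [closePairs] using this

lemma unif_ball_le (a r : ℝ) : unif {z | |z.1 - a| < r} ≤ ENNReal.ofReal (2 * r) := by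
  rw [unif, comap_subtype_coe_apply measurableSet_Icc]
  calc volume (Subtype.val '' {z : Covariate | |z.1 - a| < r})
      ≤ volume (Set.Ioo (a - r) (a + r)) := by
        refine measure_mono ?_
        rintro _ ⟨z, hz, rfl⟩
        have hz' : |z.1 - a| < r := hz
        have := abs_lt.1 hz'
        constructor <;> linarith
    _ = ENNReal.ofReal (2 * r) := by rw [Real.volume_Ioo]; congr 1; ring

lemma measurableSet_close (r : ℝ) (s t : Fin n) :
    MeasurableSet {x : Fin n → Covariate | |(x s).1 - (x t).1| < r} :=
  measurableSet_lt (by fun_prop) measurable_const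

lemma pi_unif_close_le (r : ℝ) {s t : Fin n} (hst : s ≠ t) :
    (Measure.pi fun _ : Fin n => unif) {x | |(x s).1 - (x t).1| < r} ≤
      ENNReal.ofReal (2 * r) := by
  have hind : ProbabilityTheory.IndepFun (fun x : Fin n → Covariate => x t) (fun x => x s)
      (Measure.pi fun _ : Fin n => unif) :=
    (ProbabilityTheory.iIndepFun_pi (μ := fun _ : Fin n => unif) (X := fun _ => id)
      fun _ => aemeasurable_id).indepFun hst.symm
  have hlaw := (ProbabilityTheory.indepFun_iff_map_prod_eq_prod_map_map
    (measurable_pi_apply t).aemeasurable (measurable_pi_apply s).aemeasurable).1 hind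
  have ht : Measure.map (fun x : Fin n → Covariate => x t) (Measure.pi fun _ => unif) = unif :=
    (measurePreserving_eval (fun _ : Fin n => unif) t).map_eq
  have hs : Measure.map (fun x : Fin n → Covariate => x s) (Measure.pi fun _ => unif) = unif :=
    (measurePreserving_eval (fun _ : Fin n => unif) s).map_eq
  rw [ht, hs] at hlaw
  have hE : MeasurableSet {p : Covariate × Covariate | |p.2.1 - p.1.1| < r} :=
    measurableSet_lt (by fun_prop) measurable_const
  calc (Measure.pi fun _ : Fin n => unif) {x | |(x s).1 - (x t).1| < r}
      = Measure.map (fun x : Fin n → Covariate => (x t, x s)) (Measure.pi fun _ => unif)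
          {p | |p.2.1 - p.1.1| < r} := by
        rw [Measure.map_apply (by fun_prop) hE]; rfl
    _ = ∫⁻ a, unif (Prod.mk a ⁻¹' {p | |p.2.1 - p.1.1| < r}) ∂unif := by
        rw [hlaw, Measure.prod_apply hE]
    _ ≤ ∫⁻ _a : Covariate, ENNReal.ofReal (2 * r) ∂unif :=
        lintegral_mono fun a => unif_ball_le a.1 r
    _ = ENNReal.ofReal (2 * r) := by simp

lemma measurable_closePairs (r : ℝ) : Measurable (closePairs (n := n) r) := by
  refine Finset.measurable_sum _ fun t _ => Finset.measurable_sum _ fun s _ => ?_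
  refine Measurable.ite ?_ measurable_const measurable_const
  by_cases h : s ≠ t
  · simpa [h] using measurableSet_close r s t
  · simp [h]

lemma closePairs_nonneg (r : ℝ) (x : Fin n → Covariate) : 0 ≤ closePairs r x :=
  Finset.sum_nonneg fun _ _ => Finset.sum_nonneg fun _ _ => by split_ifs <;> norm_num

lemma lintegral_closePairs_le (r : ℝ) :
    ∫⁻ x, ENNReal.ofReal (closePairs r x) ∂(Measure.pi fun _ : Fin n => unif) ≤
      ENNReal.ofReal (n ^ 2 * (2 * r)) := by
  have e : ∀ x : Fin n → Covariate, ENNReal.ofReal (closePairs r x) =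
      ∑ t, ∑ s, Set.indicator {x : Fin n → Covariate | s ≠ t ∧ |(x s).1 - (x t).1| < r} 1 x := by
    intro x
    rw [closePairs, ENNReal.ofReal_sum_of_nonneg fun _ _ =>
      Finset.sum_nonneg fun _ _ => by split_ifs <;> norm_num]
    refine Finset.sum_congr rfl fun t _ => ?_
    rw [ENNReal.ofReal_sum_of_nonneg fun _ _ => by split_ifs <;> norm_num]
    refine Finset.sum_congr rfl fun s _ => ?_
    by_cases h : s ≠ t ∧ |(x s).1 - (x t).1| < r
    · rw [if_pos h, Set.indicator_of_mem (by exact h)]; simp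
    · rw [if_neg h, Set.indicator_of_notMem (by exact h)]; simp
  have hm : ∀ s t : Fin n, MeasurableSet
      {x : Fin n → Covariate | s ≠ t ∧ |(x s).1 - (x t).1| < r} := by
    intro s t
    by_cases h : s ≠ t
    · simpa [h] using measurableSet_close r s t
    · simp [h]
  simp_rw [e]
  rw [lintegral_finsetSum _ fun t _ => Finset.measurable_sum _ fun s _ =>
    measurable_one.indicator (hm s t)]
  calc _ ≤ ∑ _t : Fin n, ∑ _s : Fin n, ENNReal.ofReal (2 * r) := by
        refine Finset.sum_le_sum fun t _ => ?_
        rw [lintegral_finsetSum _ fun s _ => measurable_one.indicator (hm s t)]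
        refine Finset.sum_le_sum fun s _ => ?_
        rw [lintegral_indicator_one (hm s t)]
        by_cases h : s = t
        · simp [h]
        · exact (measure_mono fun x hx => hx.2).trans (pi_unif_close_le r h)
    _ = ENNReal.ofReal (n ^ 2 * (2 * r)) := by
        rw [ENNReal.ofReal_mul (p := (n : ℝ) ^ 2) (by positivity),
          ENNReal.ofReal_pow (by positivity)]
        simp [sq, mul_assoc]

lemma fairLaw_closePairs_ge_le {r c ε : ℝ} (hc : 0 < c)
    (h : n ^ 2 * (2 * r) ≤ ε * c) :
    fairLaw n {s | c ≤ closePairs r s.1} ≤ ENNReal.ofReal ε := by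
  have h2 : {s : (Fin n → Covariate) × (Fin n → Bool) | c ≤ closePairs r s.1} =
      {x | ENNReal.ofReal c ≤ ENNReal.ofReal (closePairs r x)} ×ˢ Set.univ := by
    ext s
    simp [ENNReal.ofReal_le_ofReal_iff (closePairs_nonneg r s.1)]
  rw [h2, fairLaw, Measure.prod_prod, measure_univ, mul_one]
  refine (meas_ge_le_lintegral_div (measurable_closePairs r).ennreal_ofReal.aemeasurable
    (by simpa using hc) ENNReal.ofReal_ne_top).trans ?_
  rw [ENNReal.div_le_iff (by simpa using hc) ENNReal.ofReal_ne_top, ← ENNReal.ofReal_mul' hc.le]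
  exact (lintegral_closePairs_le r).trans (ENNReal.ofReal_le_ofReal h)

/-! ### A competitor that fits the isolated responses -/

/-- The triangular kernel of width `ρ`. -/
def hat (ρ u : ℝ) : ℝ := max 0 (1 - |u| / ρ)

lemma hat_nonneg (ρ u : ℝ) : 0 ≤ hat ρ u := le_max_left _ _

lemma hat_le_one {ρ : ℝ} (hρ : 0 < ρ) (u : ℝ) : hat ρ u ≤ 1 := by
  refine max_le zero_le_one ?_
  have : 0 ≤ |u| / ρ := by positivity
  linarith

lemma hat_eq_zero {ρ u : ℝ} (hρ : 0 < ρ) (hu : ρ ≤ |u|) : hat ρ u = 0 := by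
  refine max_eq_left ?_
  rw [sub_nonpos, le_div_iff₀ hρ]
  linarith

lemma abs_hat_sub_le {ρ : ℝ} (hρ : 0 < ρ) (u v : ℝ) :
    |hat ρ u - hat ρ v| ≤ min 1 (|u - v| / ρ) := by
  refine le_min ?_ ?_
  · rw [abs_le]
    constructor <;>
      linarith [hat_nonneg ρ u, hat_nonneg ρ v, hat_le_one hρ u, hat_le_one hρ v]
  · rw [hat, hat, max_comm 0, max_comm 0]
    refine (abs_max_sub_max_le_abs _ _ _).trans ?_
    rw [sub_sub_sub_cancel_left, ← sub_div, abs_div, abs_of_pos hρ, abs_sub_comm]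
    exact div_le_div_of_nonneg_right (abs_abs_sub_abs_le_abs_sub u v) hρ.le

/-- Triangular spikes of the sign of the response at the isolated covariates. -/
def spikes (ρ : ℝ) (x : Fin n → Covariate) (y : Fin n → Bool) (z : Covariate) : ℝ :=
  ∑ t ∈ isolated (2 * ρ) x, sgn (y t) * hat ρ (z.1 - (x t).1)

/-- The isolated indices whose spike does not vanish at `z`. -/
def activeSpikes (ρ : ℝ) (x : Fin n → Covariate) (z : Covariate) : Finset (Fin n) :=
  (isolated (2 * ρ) x).filter fun t => hat ρ (z.1 - (x t).1) ≠ 0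

lemma card_activeSpikes_le {ρ : ℝ} (hρ : 0 < ρ) (x : Fin n → Covariate) (z : Covariate) :
    (activeSpikes ρ x z).card ≤ 1 := by
  rw [Finset.card_le_one]
  intro s hs t ht
  simp only [activeSpikes, Finset.mem_filter, isolated, Finset.mem_univ, true_and] at hs ht
  by_contra hst
  have h1 := ht.1 s hst
  have h2 : |z.1 - (x s).1| < ρ := not_le.1 fun h => hs.2 (hat_eq_zero hρ h)
  have h3 : |z.1 - (x t).1| < ρ := not_le.1 fun h => ht.2 (hat_eq_zero hρ h)
  rw [abs_lt] at h2 h3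
  have : |(x s).1 - (x t).1| < 2 * ρ := by rw [abs_lt]; constructor <;> linarith
  linarith

lemma abs_spikes_le_one {ρ : ℝ} (hρ : 0 < ρ) (x : Fin n → Covariate) (y : Fin n → Bool)
    (z : Covariate) : |spikes ρ x y z| ≤ 1 := by
  have e : spikes ρ x y z = ∑ t ∈ activeSpikes ρ x z, sgn (y t) * hat ρ (z.1 - (x t).1) := by
    refine (Finset.sum_subset (Finset.filter_subset _ _) fun t ht h => ?_).symm
    have : hat ρ (z.1 - (x t).1) = 0 := by
      by_contra h'
      exact h (Finset.mem_filter.2 ⟨ht, h'⟩)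
    rw [this, mul_zero]
  rw [e]
  refine (Finset.abs_sum_le_sum_abs _ _).trans ?_
  refine (Finset.sum_le_card_nsmul _ _ 1 fun t _ => ?_).trans ?_
  · rw [abs_mul, abs_sgn, one_mul, abs_of_nonneg (hat_nonneg _ _)]
    exact hat_le_one hρ _
  · have := card_activeSpikes_le hρ x z
    simpa using this

lemma abs_spikes_sub_le {ρ : ℝ} (hρ : 0 < ρ) (x : Fin n → Covariate) (y : Fin n → Bool)
    (z w : Covariate) : |spikes ρ x y z - spikes ρ x y w| ≤ 2 * min 1 (|z.1 - w.1| / ρ) := by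
  have e : spikes ρ x y z - spikes ρ x y w = ∑ t ∈ activeSpikes ρ x z ∪ activeSpikes ρ x w,
      sgn (y t) * (hat ρ (z.1 - (x t).1) - hat ρ (w.1 - (x t).1)) := by
    rw [spikes, spikes, ← Finset.sum_sub_distrib]
    simp only [← mul_sub]
    refine (Finset.sum_subset (Finset.union_subset (Finset.filter_subset _ _)
      (Finset.filter_subset _ _)) fun t ht h => ?_).symm
    simp only [Finset.mem_union, Finset.mem_filter, ht, true_and, not_or,
      not_not] at h
    rw [h.1, h.2, sub_zero, mul_zero]
  rw [e]
  refine (Finset.abs_sum_le_sum_abs _ _).trans ?_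
  refine (Finset.sum_le_card_nsmul _ _ (min 1 (|z.1 - w.1| / ρ)) fun t _ => ?_).trans ?_
  · rw [abs_mul, abs_sgn, one_mul]
    refine (abs_hat_sub_le hρ _ _).trans (le_of_eq ?_)
    rw [sub_sub_sub_cancel_right]
  · rw [nsmul_eq_mul]
    refine mul_le_mul_of_nonneg_right ?_ (by positivity)
    have h1 := card_activeSpikes_le hρ x z
    have h2 := card_activeSpikes_le hρ x w
    have h3 := Finset.card_union_le (activeSpikes ρ x z) (activeSpikes ρ x w)
    exact_mod_cast h3.trans (by omega)

lemma min_one_le_rpow {u α : ℝ} (hu : 0 ≤ u) (hα0 : 0 ≤ α) (hα : α ≤ 1) : min 1 u ≤ u ^ α := by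
  rcases le_total 1 u with h | h
  · exact (min_le_left _ _).trans (Real.one_le_rpow h hα0)
  · exact (min_le_right _ _).trans (Real.self_le_rpow_of_le_one hu h hα)

lemma abs_spikes_sub_le_rpow {ρ α : ℝ} (hρ : 0 < ρ) (hα0 : 0 ≤ α) (hα : α ≤ 1)
    (x : Fin n → Covariate) (y : Fin n → Bool) (z w : Covariate) :
    ρ ^ α * |spikes ρ x y z - spikes ρ x y w| ≤ 2 * |z.1 - w.1| ^ α := by
  have h1 := abs_spikes_sub_le hρ x y z w
  have h2 := min_one_le_rpow (u := |z.1 - w.1| / ρ) (by positivity) hα0 hα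
  rw [Real.div_rpow (abs_nonneg _) hρ.le] at h2
  have hq : 0 < ρ ^ α := Real.rpow_pos_of_pos hρ α
  rw [le_div_iff₀ hq] at h2
  nlinarith

lemma spikes_apply_of_mem {ρ : ℝ} (hρ : 0 < ρ) (x : Fin n → Covariate) (y : Fin n → Bool)
    {t : Fin n} (ht : t ∈ isolated (2 * ρ) x) : spikes ρ x y (x t) = sgn (y t) := by
  rw [spikes, Finset.sum_eq_single_of_mem t ht]
  · simp [hat]
  · intro s hs hst
    simp only [isolated, Finset.mem_filter, Finset.mem_univ, true_and] at hs
    rw [hat_eq_zero hρ, mul_zero]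
    linarith [hs t hst.symm]

lemma spikes_apply_of_notMem {ρ : ℝ} (hρ : 0 < ρ) (x : Fin n → Covariate) (y : Fin n → Bool)
    {t : Fin n} (ht : t ∉ isolated (2 * ρ) x) : spikes ρ x y (x t) = 0 := by
  refine Finset.sum_eq_zero fun s hs => ?_
  have hst : t ≠ s := fun h => ht (h ▸ hs)
  simp only [isolated, Finset.mem_filter, Finset.mem_univ, true_and] at hs
  rw [hat_eq_zero hρ, mul_zero]
  linarith [hs t hst]

lemma sum_sgn_mul_spikes {ρ : ℝ} (hρ : 0 < ρ) (x : Fin n → Covariate) (y : Fin n → Bool) :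
    ∑ t, sgn (y t) * spikes ρ x y (x t) = (isolated (2 * ρ) x).card := by
  have : ∀ t, sgn (y t) * spikes ρ x y (x t) = if t ∈ isolated (2 * ρ) x then 1 else 0 := by
    intro t
    split_ifs with h
    · rw [spikes_apply_of_mem hρ x y h, sgn_mul_self]
    · rw [spikes_apply_of_notMem hρ x y h, mul_zero]
  simp [this]

/-- A member of the class that fits the responses at isolated covariates. -/
def competitor (γ ρ : ℝ) (x : Fin n → Covariate) (y : Fin n → Bool) (z : Covariate) : ℝ :=
  1 / 2 + (1 / 108 * ρ ^ (γ / 2) + 1 / 864 * ρ ^ γ * spikes ρ x y z)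

lemma rpow_eq_sq {ρ : ℝ} (hρ : 0 < ρ) (γ : ℝ) : ρ ^ γ = (ρ ^ (γ / 2)) ^ 2 := by
  rw [← Real.rpow_mul_natCast hρ.le]; congr 1; push_cast; ring

lemma competitor_mem {γ ρ : ℝ} (hγ : 0 < γ) (hγ1 : γ ≤ 1) (hρ : 0 < ρ) (hρ1 : ρ ≤ 1)
    (x : Fin n → Covariate) (y : Fin n → Bool) : competitor γ ρ x y ∈ offsetClass γ := by
  have hq : 0 < ρ ^ (γ / 2) := Real.rpow_pos_of_pos hρ _
  have hq1 : ρ ^ (γ / 2) ≤ 1 := Real.rpow_le_one hρ.le hρ1 (by linarith)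
  have hsq := rpow_eq_sq hρ γ
  have hH : |1 / 864 * ρ ^ γ * spikes ρ x y origin| ≤ 1 / 864 * ρ ^ (γ / 2) := by
    rw [abs_mul, abs_of_nonneg (by positivity), hsq]
    have := abs_spikes_le_one hρ x y origin
    nlinarith [abs_nonneg (spikes ρ x y origin), mul_pos hq hq]
  rw [abs_le] at hH
  have hd : ∀ z w, |competitor γ ρ x y z - competitor γ ρ x y w| =
      1 / 864 * ρ ^ γ * |spikes ρ x y z - spikes ρ x y w| := by
    intro z w
    rw [competitor, competitor, add_sub_add_left_eq_sub, add_sub_add_left_eq_sub, ← mul_sub,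
      abs_mul, abs_of_nonneg (by positivity)]
  refine ⟨fun z w => ?_, fun z w => ?_, ?_⟩
  · rw [hd]
    have := abs_spikes_sub_le_rpow hρ hγ.le hγ1 x y z w
    have : 0 ≤ |z.1 - w.1| ^ γ := by positivity
    linarith
  · rw [hd, hsq]
    have h := abs_spikes_sub_le_rpow hρ (show 0 ≤ γ / 2 by linarith) (by linarith) x y z w
    have hnn : 0 ≤ |z.1 - w.1| ^ (γ / 2) := by positivity
    calc 1 / 864 * (ρ ^ (γ / 2)) ^ 2 * |spikes ρ x y z - spikes ρ x y w|
        = 1 / 864 * ρ ^ (γ / 2) * (ρ ^ (γ / 2) * |spikes ρ x y z - spikes ρ x y w|) := by ring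
      _ ≤ 1 / 864 * ρ ^ (γ / 2) * (2 * |z.1 - w.1| ^ (γ / 2)) :=
          mul_le_mul_of_nonneg_left h (by positivity)
      _ = 1 / 432 * ρ ^ (γ / 2) * |z.1 - w.1| ^ (γ / 2) := by ring
      _ ≤ _ := by
          refine mul_le_mul_of_nonneg_right ?_ hnn
          rw [competitor]
          linarith
  · rw [competitor]
    constructor <;> linarith

/-! ### Likelihood gains -/

lemma logLik_sub_logLik_half {f : Covariate → ℝ} (hf : ∀ x, f x ∈ Set.Icc (7 / 16 : ℝ) (9 / 16))
    (x : Fin n → Covariate) (y : Fin n → Bool) :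
    logLik x y f - logLik x y (fun _ => 1 / 2) =
      ∑ t, Real.log (1 + 2 * (sgn (y t) * (f (x t) - 1 / 2))) := by
  rw [logLik, logLik, ← Finset.sum_sub_distrib]
  refine Finset.sum_congr rfl fun t _ => ?_
  have h := bernDensity_pos (hf (x t)) (y t)
  rw [bernDensity_eq] at h
  rw [bernDensity_eq, bernDensity_eq, Real.log_mul (by norm_num) fun h0 => by simp only [h0] at h; simp at h]
  simp

lemma sub_sq_le_log_one_add {u : ℝ} (hu : |u| ≤ 1 / 2) : u - 2 * u ^ 2 ≤ Real.log (1 + u) := by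
  have h := Real.abs_log_sub_add_sum_range_le (x := -u) (by rw [abs_neg]; linarith) 1
  simp only [Finset.sum_range_one, zero_add, pow_one, sub_neg_eq_add, abs_neg] at h
  have h2 : |u| ^ (1 + 1) / (1 - |u|) ≤ 2 * u ^ 2 := by
    rw [div_le_iff₀ (by linarith), ← sq_abs u]
    norm_num
    nlinarith [sq_nonneg u]
  have h3 := (abs_le.1 h).1
  norm_num at h3
  norm_num at h2
  linarith

lemma logLik_gain_le {γ : ℝ} (hγ : 0 < γ) (hγ1 : γ ≤ 1) {f : Covariate → ℝ}
    (hf : f ∈ offsetClass γ) (J : ℕ) (x : Fin n → Covariate) (y : Fin n → Bool) :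
    logLik x y f - logLik x y (fun _ => 1 / 2) ≤
      4 * (f origin - 1 / 2) * chainSum γ J x y + 2 * (n * ((1 / 2 : ℝ) ^ J) ^ γ) := by
  have hb := hf.2.2.1
  have h1 : ∑ t, sgn (y t) * (f (x t) - 1 / 2) ≤
      2 * (f origin - 1 / 2) * chainSum γ J x y + n * ((1 / 2 : ℝ) ^ J) ^ γ := by
    refine sum_sgn_mul_le (g := fun z => f z - 1 / 2) hγ hγ1 (by linarith) ?_ ?_ ?_ J x y
    · intro z
      have h1 := excess_ge hγ hf z
      have h2 := excess_le hγ hf z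
      rw [abs_le]; constructor <;> linarith
    · intro z w
      rw [sub_sub_sub_cancel_right]
      refine (hf.2.1 z w).trans (mul_le_mul_of_nonneg_right ?_ (by positivity))
      linarith
    · intro z w
      rw [sub_sub_sub_cancel_right]
      exact hf.1 z w
  rw [logLik_sub_logLik_half (mem_Icc_of_mem_offsetClass hγ hf)]
  have h2 : ∑ t, Real.log (1 + 2 * (sgn (y t) * (f (x t) - 1 / 2))) ≤
      ∑ t, 2 * (sgn (y t) * (f (x t) - 1 / 2)) := by
    refine Finset.sum_le_sum fun t _ => ?_
    have h := bernDensity_pos (mem_Icc_of_mem_offsetClass hγ hf (x t)) (y t)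
    rw [bernDensity_eq] at h
    have := Real.log_le_sub_one_of_pos
      (show 0 < 1 + 2 * (sgn (y t) * (f (x t) - 1 / 2)) by linarith)
    linarith
  rw [← Finset.mul_sum] at h2
  linarith

lemma le_logLik_gain_competitor {γ ρ : ℝ} (hγ : 0 < γ) (hγ1 : γ ≤ 1) (hρ : 0 < ρ) (hρ1 : ρ ≤ 1)
    (x : Fin n → Covariate) (y : Fin n → Bool) (hx : closePairs (2 * ρ) x ≤ n / 4) :
    1 / 1152 * (n * ρ ^ γ) - 1 / 54 * ρ ^ (γ / 2) * |∑ t, sgn (y t)| ≤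
      logLik x y (competitor γ ρ x y) - logLik x y (fun _ => 1 / 2) := by
  have hmem := competitor_mem hγ hγ1 hρ hρ1 x y
  rw [logLik_sub_logLik_half (mem_Icc_of_mem_offsetClass hγ hmem)]
  have hq : 0 < ρ ^ (γ / 2) := Real.rpow_pos_of_pos hρ _
  have hq1 : ρ ^ (γ / 2) ≤ 1 := Real.rpow_le_one hρ.le hρ1 (by linarith)
  have hsq := rpow_eq_sq hρ γ
  set q := ρ ^ (γ / 2) with hqdef
  have hlog : ∀ t, 2 * (sgn (y t) * (1 / 108 * q + 1 / 864 * ρ ^ γ * spikes ρ x y (x t))) -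
      8 * (1 / 96 * q) ^ 2 ≤
      Real.log (1 + 2 * (sgn (y t) * (competitor γ ρ x y (x t) - 1 / 2))) := by
    intro t
    have e : competitor γ ρ x y (x t) - 1 / 2 =
        1 / 108 * q + 1 / 864 * ρ ^ γ * spikes ρ x y (x t) := by
      rw [competitor]; ring
    rw [e]
    set g := 1 / 108 * q + 1 / 864 * ρ ^ γ * spikes ρ x y (x t) with hg
    have hgabs : |g| ≤ 1 / 96 * q := by
      have h1 : |1 / 864 * ρ ^ γ * spikes ρ x y (x t)| ≤ 1 / 864 * q := by
        rw [abs_mul, abs_of_nonneg (by positivity), hsq]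
        have := abs_spikes_le_one hρ x y (x t)
        nlinarith [abs_nonneg (spikes ρ x y (x t)), mul_pos hq hq]
      rw [abs_le] at h1 ⊢
      constructor <;> linarith
    have hu : |2 * (sgn (y t) * g)| = 2 * |g| := by
      rw [abs_mul, abs_mul, abs_sgn, one_mul, abs_of_pos (by norm_num : (0 : ℝ) < 2)]
    have hl := sub_sq_le_log_one_add (u := 2 * (sgn (y t) * g)) (by rw [hu]; linarith)
    have : (2 * (sgn (y t) * g)) ^ 2 ≤ 4 * (1 / 96 * q) ^ 2 := by
      rw [← sq_abs, hu]
      nlinarith [abs_nonneg g]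
    linarith
  refine le_trans ?_ (Finset.sum_le_sum fun t (_ : t ∈ Finset.univ) => hlog t)
  have e : ∑ t, (2 * (sgn (y t) * (1 / 108 * q + 1 / 864 * ρ ^ γ * spikes ρ x y (x t))) -
      8 * (1 / 96 * q) ^ 2) = 1 / 54 * q * ∑ t, sgn (y t) +
      1 / 432 * ρ ^ γ * ∑ t, sgn (y t) * spikes ρ x y (x t) - n * (8 * (1 / 96 * q) ^ 2) := by
    rw [Finset.sum_sub_distrib, Finset.mul_sum, Finset.mul_sum, ← Finset.sum_add_distrib]
    simp only [Finset.sum_const, Finset.card_univ, Fintype.card_fin, nsmul_eq_mul]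
    congr 1
    exact Finset.sum_congr rfl fun t _ => by ring
  rw [e, sum_sgn_mul_spikes hρ, hsq]
  have h1 := neg_abs_le (∑ t, sgn (y t))
  have h2 := sub_closePairs_le_card_isolated (2 * ρ) x
  have h3 : (3 / 4 : ℝ) * n ≤ (isolated (2 * ρ) x).card := by linarith
  have h4 := mul_le_mul_of_nonneg_left h3 (show 0 ≤ 1 / 432 * q ^ 2 by positivity)
  have h5 := mul_le_mul_of_nonneg_left h1 (show 0 ≤ 1 / 54 * q by positivity)
  linarith

end Sample

/-! ### The offset of the maximum likelihood estimate -/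

/-- The lower bound for the offset of a maximum likelihood estimate on a sample with few close
pairs of covariates, a small sum of signs and a small chaining sum. -/
lemma le_offset_of_isMLE {γ : ℝ} (hγ : 0 < γ) (hγ1 : γ ≤ 1) {n J : ℕ} {a c p τ A B S η : ℝ}
    (hn : 0 < n) (hτ : 0 < τ) (hτ1 : τ ≤ 1) (hA : 0 < A) (hp : p = (n : ℝ) ^ (γ / 2))
    (ha : a = (τ / 2) ^ (γ / 2)) (hc : c = a ^ 2 / 1152) (hAc : 8 / c ≤ A ^ γ)
    (hJ : A * n ≤ 2 ^ J) (hη : 4 * (η * B) ≤ c / 4) (hB : 0 ≤ B)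
    (hS : a / 54 * (p * S) ≤ c / 4 * n)
    {x : Fin n → Covariate} {y : Fin n → Bool} (hx : closePairs (τ / n) x ≤ n / 4)
    (hy : |∑ t, sgn (y t)| ≤ S) (hQ : chainSum γ J x y ≤ B * (n / p))
    {f : Covariate → ℝ} (hf : IsMLE (offsetClass γ) x y f) : η / p ≤ f origin - 1 / 2 := by
  have hn0 : (0 : ℝ) < n := by exact_mod_cast hn
  have hn1 : (1 : ℝ) ≤ n := by exact_mod_cast hn
  have hp0 : 0 < p := hp ▸ Real.rpow_pos_of_pos hn0 _
  have ha0 : 0 < a := ha ▸ Real.rpow_pos_of_pos (by positivity) _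
  have hc0 : 0 < c := by rw [hc]; positivity
  by_contra! hlt
  have hρ0 : 0 < τ / 2 / n := by positivity
  have hρ1 : τ / 2 / n ≤ 1 := by rw [div_le_one hn0]; linarith
  have hq : (τ / 2 / n) ^ (γ / 2) = a / p := by
    rw [Real.div_rpow (by positivity) hn0.le, ha, hp]
  have hr : 2 * (τ / 2 / n) = τ / n := by ring
  have hlow := le_logLik_gain_competitor hγ hγ1 hρ0 hρ1 x y (by rwa [hr])
  rw [rpow_eq_sq hρ0, hq] at hlow
  have hup := logLik_gain_le hγ hγ1 hf.1 J x y
  have hmle := hf.2 _ (competitor_mem hγ hγ1 hρ0 hρ1 x y)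
  have h1 : 2 * (n * ((1 / 2 : ℝ) ^ J) ^ γ) ≤ c / 4 * (n / p ^ 2) := by
    have e1 : (1 / 2 : ℝ) ^ J ≤ 1 / (A * n) := by
      rw [one_div_pow]
      exact one_div_le_one_div_of_le (by positivity) hJ
    have e2 : ((1 / 2 : ℝ) ^ J) ^ γ ≤ (1 / (A * n)) ^ γ :=
      Real.rpow_le_rpow (by positivity) e1 hγ.le
    have e3 : (1 / (A * n)) ^ γ = 1 / (A ^ γ * p ^ 2) := by
      rw [Real.div_rpow (by norm_num) (by positivity), Real.mul_rpow hA.le hn0.le, Real.one_rpow,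
        rpow_eq_sq hn0 γ, hp]
    have e4 : 1 / (A ^ γ * p ^ 2) ≤ 1 / (8 / c * p ^ 2) :=
      one_div_le_one_div_of_le (by positivity) (mul_le_mul_of_nonneg_right hAc (by positivity))
    have e5 : 1 / (8 / c * p ^ 2) = c / 8 * (1 / p ^ 2) := by field_simp
    have e6 : ((1 / 2 : ℝ) ^ J) ^ γ ≤ c / 8 * (1 / p ^ 2) := by
      rw [← e5]; exact e2.trans (e3 ▸ e4)
    calc 2 * (n * ((1 / 2 : ℝ) ^ J) ^ γ) ≤ 2 * (n * (c / 8 * (1 / p ^ 2))) := by gcongr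
      _ = c / 4 * (n / p ^ 2) := by ring
  have h2 : 4 * (f origin - 1 / 2) * chainSum γ J x y ≤ c / 4 * (n / p ^ 2) := by
    have hb := hf.1.2.2.1
    calc 4 * (f origin - 1 / 2) * chainSum γ J x y
        ≤ 4 * (f origin - 1 / 2) * (B * (n / p)) :=
          mul_le_mul_of_nonneg_left hQ (by linarith)
      _ ≤ 4 * (η / p) * (B * (n / p)) :=
          mul_le_mul_of_nonneg_right (by linarith) (by positivity)
      _ = 4 * (η * B) * (n / p ^ 2) := by field_simp
      _ ≤ c / 4 * (n / p ^ 2) := mul_le_mul_of_nonneg_right hη (by positivity)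
  have h3 : 1 / 54 * (a / p) * |∑ t, sgn (y t)| ≤ c / 4 * (n / p ^ 2) := by
    calc 1 / 54 * (a / p) * |∑ t, sgn (y t)| ≤ 1 / 54 * (a / p) * S :=
          mul_le_mul_of_nonneg_left hy (by positivity)
      _ = a / 54 * (p * S) * (1 / p ^ 2) := by field_simp
      _ ≤ c / 4 * n * (1 / p ^ 2) := mul_le_mul_of_nonneg_right hS (by positivity)
      _ = _ := by ring
  have h4 : 1 / 1152 * (n * (a / p) ^ 2) = c * (n / p ^ 2) := by rw [hc]; field_simp
  have h5 : 0 < c * (n / p ^ 2) := by positivity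
  linarith

lemma eventually_rpow_mul_sqrt_le {γ : ℝ} (hγ : γ < 1) (L : ℝ) :
    ∀ᶠ n : ℕ in atTop, L * ((n : ℝ) ^ (γ / 2) * √n) ≤ n := by
  have h := ((tendsto_rpow_atTop (show 0 < (1 - γ) / 2 by linarith)).comp
    tendsto_natCast_atTop_atTop).eventually_ge_atTop L
  filter_upwards [h, eventually_gt_atTop 0] with n hL hn
  have hn0 : (0 : ℝ) < n := by exact_mod_cast hn
  calc L * ((n : ℝ) ^ (γ / 2) * √n)
      ≤ (n : ℝ) ^ ((1 - γ) / 2) * ((n : ℝ) ^ (γ / 2) * √n) :=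
        mul_le_mul_of_nonneg_right hL (by positivity)
    _ = n := by
        rw [Real.sqrt_eq_rpow, ← Real.rpow_add hn0, ← Real.rpow_add hn0]
        conv_rhs => rw [← Real.rpow_one (n : ℝ)]
        congr 1
        ring

lemma sqrt_mul_rpow {n γ : ℝ} (hn : 0 < n) :
    √n * n ^ ((1 - γ) / 2) = n / n ^ (γ / 2) := by
  rw [Real.sqrt_eq_rpow, ← Real.rpow_add hn, eq_div_iff (Real.rpow_pos_of_pos hn _).ne',
    ← Real.rpow_add hn]
  conv_rhs => rw [← Real.rpow_one n]
  congr 1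
  ring

lemma measurable_sum_sgn {n : ℕ} : Measurable
    fun s : (Fin n → Covariate) × (Fin n → Bool) => ∑ t, sgn (s.2 t) :=
  Finset.measurable_sum _ fun _ _ => (measurable_of_finite sgn).comp (by fun_prop)

/-- With probability at least `1 - ε`, every maximum likelihood estimate has an offset of order at
least `n^{-γ/2}`. -/
lemma exists_eventually_le_offset {γ : ℝ} (hγ : 0 < γ) (hγ1 : γ < 1) {ε : ℝ} (hε : 0 < ε) :
    ∃ η : ℝ, 0 < η ∧ ∀ᶠ n : ℕ in atTop, ∃ G : Set ((Fin n → Covariate) × (Fin n → Bool)),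
      MeasurableSet G ∧ fairLaw n Gᶜ ≤ ENNReal.ofReal ε ∧
      ∀ s ∈ G, ∀ f, IsMLE (offsetClass γ) s.1 s.2 f →
        η / (n : ℝ) ^ (γ / 2) ≤ f origin - 1 / 2 := by
  set δ : ℝ := ε / 3 with hδ
  have hδ0 : 0 < δ := by positivity
  set τ : ℝ := min 1 (δ / 8) with hτ
  have hτ0 : 0 < τ := lt_min one_pos (by positivity)
  set a : ℝ := (τ / 2) ^ (γ / 2) with ha
  have ha0 : 0 < a := Real.rpow_pos_of_pos (by positivity) _
  set c : ℝ := a ^ 2 / 1152 with hc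
  have hc0 : 0 < c := by positivity
  obtain ⟨A, hAc, hA1⟩ := (((tendsto_rpow_atTop hγ).eventually_ge_atTop (8 / c)).and
    (eventually_ge_atTop 1)).exists
  have hA0 : 0 < A := by linarith
  have hC := chainConst_pos hγ1
  set B : ℝ := chainConst γ * (2 * A) ^ ((1 - γ) / 2) / δ with hB
  have hB0 : 0 < B := by positivity
  refine ⟨c / (16 * B), by positivity, ?_⟩
  filter_upwards [eventually_gt_atTop 0,
    eventually_rpow_mul_sqrt_le hγ1 (a / 54 * (4 / c) * √(1 / δ))] with n hn hL
  have hn0 : (0 : ℝ) < n := by exact_mod_cast hn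
  have hn1 : (1 : ℝ) ≤ n := by exact_mod_cast hn
  obtain ⟨k, hk1, hk2⟩ := exists_nat_pow_near (x := A * n) (y := 2) (by nlinarith) one_lt_two
  set J := k + 1 with hJ
  have hJ2 : (2 : ℝ) ^ J ≤ 2 * A * n := by rw [hJ, pow_succ]; linarith
  set p : ℝ := (n : ℝ) ^ (γ / 2) with hp
  have hp0 : 0 < p := Real.rpow_pos_of_pos hn0 _
  have hBn : chainConst γ * √n * ((2 : ℝ) ^ J) ^ ((1 - γ) / 2) ≤ δ * (B * (n / p)) := by
    calc chainConst γ * √n * ((2 : ℝ) ^ J) ^ ((1 - γ) / 2)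
        ≤ chainConst γ * √n * (2 * A * n) ^ ((1 - γ) / 2) :=
          mul_le_mul_of_nonneg_left (Real.rpow_le_rpow (by positivity) hJ2 (by linarith))
            (by positivity)
      _ = chainConst γ * (2 * A) ^ ((1 - γ) / 2) * (√n * (n : ℝ) ^ ((1 - γ) / 2)) := by
          rw [Real.mul_rpow (by positivity) hn0.le]; ring
      _ = δ * (B * (n / p)) := by
          rw [sqrt_mul_rpow hn0, ← hp, hB]; field_simp
  let E₁ : Set ((Fin n → Covariate) × (Fin n → Bool)) := {s | (n : ℝ) / 4 ≤ closePairs (τ / n) s.1}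
  let E₂ : Set ((Fin n → Covariate) × (Fin n → Bool)) := {s | (n : ℝ) / δ ≤ (∑ t, sgn (s.2 t)) ^ 2}
  let E₃ : Set ((Fin n → Covariate) × (Fin n → Bool)) := {s | B * (n / p) ≤ chainSum γ J s.1 s.2}
  have hE₁ : fairLaw n E₁ ≤ ENNReal.ofReal δ := by
    refine fairLaw_closePairs_ge_le (by positivity) ?_
    have : τ ≤ δ / 8 := min_le_right _ _
    have e : (n : ℝ) ^ 2 * (2 * (τ / n)) = 2 * τ * n := by field_simp
    rw [e]
    nlinarith
  have hE₂ : fairLaw n E₂ ≤ ENNReal.ofReal δ := by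
    refine fairLaw_ge_le (measurable_sum_sgn.pow_const 2) (fun _ => sq_nonneg _)
      (B := n) (by positivity) (le_of_eq (by field_simp)) fun x => ?_
    have := integral_sq_sum_sgn (fun _ : Fin n => (1 : ℝ))
    simp only [one_mul, one_pow, Finset.sum_const, Finset.card_univ, Fintype.card_fin,
      nsmul_eq_mul, mul_one] at this
    exact this.le
  have hE₃ : fairLaw n E₃ ≤ ENNReal.ofReal δ :=
    fairLaw_ge_le (measurable_chainSum γ J) (fun _ => chainSum_nonneg _ _ _ _) (by positivity) hBn
      fun x => integral_chainSum_le hγ1 hn J x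
  refine ⟨(E₁ ∪ E₂ ∪ E₃)ᶜ, ?_, ?_, ?_⟩
  · refine ((MeasurableSet.union ?_ ?_).union ?_).compl
    · exact measurableSet_le measurable_const ((measurable_closePairs _).comp measurable_fst)
    · exact measurableSet_le measurable_const (measurable_sum_sgn.pow_const 2)
    · exact measurableSet_le measurable_const (measurable_chainSum γ J)
  · rw [compl_compl]
    calc fairLaw n (E₁ ∪ E₂ ∪ E₃) ≤ fairLaw n E₁ + fairLaw n E₂ + fairLaw n E₃ :=
          (measure_union_le _ _).trans (add_le_add_left (measure_union_le _ _) _)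
      _ ≤ ENNReal.ofReal δ + ENNReal.ofReal δ + ENNReal.ofReal δ := by gcongr
      _ = ENNReal.ofReal ε := by
          rw [← ENNReal.ofReal_add hδ0.le hδ0.le, ← ENNReal.ofReal_add (by positivity) hδ0.le]
          congr 1; rw [hδ]; ring
  · intro s hs f hf
    simp only [Set.mem_compl_iff, Set.mem_union, not_or] at hs
    obtain ⟨⟨h1, h2⟩, h3⟩ := hs
    have h1 : closePairs (τ / n) s.1 < n / 4 := not_le.1 h1
    have h2 : (∑ t, sgn (s.2 t)) ^ 2 < n / δ := not_le.1 h2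
    have h3 : chainSum γ J s.1 s.2 < B * (n / p) := not_le.1 h3
    refine le_offset_of_isMLE (S := √(1 / δ) * √n) hγ hγ1.le hn hτ0 (min_le_left _ _) hA0 hp ha hc
      hAc hk2.le (le_of_eq ?_) hB0.le ?_ h1.le ?_ h3.le hf
    · field_simp; norm_num
    · have := mul_le_mul_of_nonneg_left hL (show 0 ≤ c / 4 by positivity)
      refine le_trans (le_of_eq ?_) this
      field_simp
    · rw [← Real.sqrt_mul (by positivity)]
      refine Real.le_sqrt_of_sq_le ?_
      rw [sq_abs, div_mul_eq_mul_div, one_mul]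
      exact h2.le

section Regressogram

variable {n : ℕ}

/-! ### The risk of the regressogram -/

/-- The index of the bin of length `1/m` that contains `z`. -/
def bin (m : ℕ) (z : Covariate) : ℕ := ⌊(z.1 + 1 / 2) * m⌋₊

/-- The indicator function of the `k`-th bin. -/
def binInd (m k : ℕ) (z : Covariate) : ℝ := if bin m z = k then 1 else 0

/-- The number of covariates in the `k`-th bin. -/
def binCount (m k : ℕ) (x : Fin n → Covariate) : ℝ := ∑ t, binInd m k (x t)

/-- The shrunken mean of the responses in the `k`-th bin. -/
def binMean (m k : ℕ) (x : Fin n → Covariate) (y : Fin n → Bool) : ℝ :=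
  (1 / 2 + ∑ t, binInd m k (x t) * bernDensity 1 (y t)) / (1 + binCount m k x)

/-- The noise in the `k`-th bin: the sum of the centered responses. -/
def binNoise (f : Covariate → ℝ) (m k : ℕ) (x : Fin n → Covariate) (y : Fin n → Bool) : ℝ :=
  ∑ t, binInd m k (x t) * (bernDensity 1 (y t) - f (x t))

/-- The estimator that is the clipped mean response on each bin. -/
def regressogram (m : ℕ) (x : Fin n → Covariate) (y : Fin n → Bool) (z : Covariate) : ℝ :=
  max (7 / 16) (min (9 / 16) (binMean m (bin m z) x y))

lemma measurable_bin (m : ℕ) : Measurable (bin m) := Nat.measurable_floor.comp (by fun_prop)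

lemma measurable_binInd (m k : ℕ) : Measurable (binInd m k) :=
  Measurable.ite (measurable_bin m (measurableSet_singleton k)) measurable_const measurable_const

lemma binInd_nonneg (m k : ℕ) (z : Covariate) : 0 ≤ binInd m k z := by
  unfold binInd; split_ifs <;> norm_num

lemma binInd_le_one (m k : ℕ) (z : Covariate) : binInd m k z ≤ 1 := by
  unfold binInd; split_ifs <;> norm_num

lemma binInd_sq (m k : ℕ) (z : Covariate) : binInd m k z ^ 2 = binInd m k z := by
  unfold binInd; split_ifs <;> norm_num

lemma binCount_nonneg (m k : ℕ) (x : Fin n → Covariate) : 0 ≤ binCount m k x :=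
  Finset.sum_nonneg fun _ _ => binInd_nonneg _ _ _

lemma measurable_binCount (m k : ℕ) : Measurable (binCount (n := n) m k) :=
  Finset.measurable_sum _ fun t _ => (measurable_binInd m k).comp (measurable_pi_apply t)

lemma bin_lt (m : ℕ) (z : Covariate) : bin m z < m + 1 := by
  rw [Nat.lt_succ_iff]
  refine Nat.floor_le_of_le ?_
  refine mul_le_of_le_one_left (by positivity) ?_
  have := z.2.2; linarith

lemma abs_sub_le_of_bin_eq {m : ℕ} (hm : 0 < m) {z w : Covariate} (h : bin m z = bin m w) :
    |z.1 - w.1| ≤ 1 / m := by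
  have hm0 : (0 : ℝ) < m := by exact_mod_cast hm
  have z1 : (bin m z : ℝ) ≤ (z.1 + 1 / 2) * m :=
    Nat.floor_le (mul_nonneg z.add_half_nonneg hm0.le)
  have z2 : (z.1 + 1 / 2) * m < bin m z + 1 := Nat.lt_floor_add_one _
  have w1 : (bin m w : ℝ) ≤ (w.1 + 1 / 2) * m :=
    Nat.floor_le (mul_nonneg w.add_half_nonneg hm0.le)
  have w2 : (w.1 + 1 / 2) * m < bin m w + 1 := Nat.lt_floor_add_one _
  rw [h] at z1 z2
  rw [le_div_iff₀ hm0, ← abs_of_pos hm0, ← abs_mul, abs_le]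
  constructor <;> linarith

lemma regressogram_mem_Icc (m : ℕ) (x : Fin n → Covariate) (y : Fin n → Bool) (z : Covariate) :
    regressogram m x y z ∈ Set.Icc (7 / 16 : ℝ) (9 / 16) :=
  ⟨le_max_left _ _, max_le (by norm_num) (min_le_left _ _)⟩

lemma isEstimator_regressogram (m : ℕ) : IsEstimator (regressogram (n := n) m) where
  mem_Icc x y z := by
    have := regressogram_mem_Icc m x y z
    exact ⟨by linarith [this.1], by linarith [this.2]⟩
  measurable := by
    have hi : ∀ t : Fin n, Measurable
        fun p : ((Fin n → Covariate) × (Fin n → Bool)) × Covariate =>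
          binInd m (bin m p.2) (p.1.1 t) := fun t => by
      refine Measurable.ite (measurableSet_eq_fun ?_ ?_) measurable_const measurable_const
      · exact (measurable_bin m).comp (by fun_prop)
      · exact (measurable_bin m).comp (by fun_prop)
    have hd : Measurable (bernDensity 1) := measurable_of_finite _
    refine measurable_const.max (measurable_const.min (Measurable.div ?_ ?_))
    · refine measurable_const.add (Finset.measurable_sum _ fun t _ => (hi t).mul ?_)
      exact hd.comp (by fun_prop)
    · exact measurable_const.add (Finset.measurable_sum _ fun t _ => hi t)

/-- A bound for the squared error of the regressogram on the `k`-th bin. -/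
def binError (γ : ℝ) (f : Covariate → ℝ) (m k : ℕ) (x : Fin n → Covariate)
    (y : Fin n → Bool) : ℝ :=
  3 * (((1 / m : ℝ) ^ γ) ^ 2 + (1 + binNoise f m k x y ^ 2) / (1 + binCount m k x) ^ 2)

lemma binError_nonneg (γ : ℝ) (f : Covariate → ℝ) (m k : ℕ) (x : Fin n → Covariate)
    (y : Fin n → Bool) : 0 ≤ binError γ f m k x y := by
  unfold binError; positivity

lemma sq_clip_sub_le {u v : ℝ} (hv : v ∈ Set.Icc (7 / 16 : ℝ) (9 / 16)) :
    (v - max (7 / 16) (min (9 / 16) u)) ^ 2 ≤ (v - u) ^ 2 := by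
  obtain ⟨h1, h2⟩ := hv
  rcases le_total u (7 / 16) with h | h
  · rw [min_eq_right (by linarith), max_eq_left h]; nlinarith
  · rcases le_total u (9 / 16) with h' | h'
    · rw [min_eq_right h', max_eq_right h]
    · rw [min_eq_left h', max_eq_right (by norm_num)]; nlinarith

lemma sq_regressogram_sub_le {γ : ℝ} (hγ : 0 < γ) {f : Covariate → ℝ} (hf : f ∈ offsetClass γ)
    {m : ℕ} (hm : 0 < m) (x : Fin n → Covariate) (y : Fin n → Bool) (z : Covariate) :
    (f z - regressogram m x y z) ^ 2 ≤ binError γ f m (bin m z) x y := by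
  have hfz := mem_Icc_of_mem_offsetClass hγ hf z
  refine (sq_clip_sub_le hfz).trans ?_
  set k := bin m z with hk
  set N := binCount m k x with hN
  set V := binNoise f m k x y with hV
  set h : ℝ := (1 / m : ℝ) ^ γ with hh
  set W := ∑ t, binInd m k (x t) * (f (x t) - f z) with hW
  have hh0 : 0 ≤ h := by positivity
  have hN0 : 0 ≤ N := binCount_nonneg m k x
  have hWabs : |W| ≤ N * h := by
    rw [hW, hN, binCount, Finset.sum_mul]
    refine (Finset.abs_sum_le_sum_abs _ _).trans (Finset.sum_le_sum fun t _ => ?_)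
    rw [abs_mul, abs_of_nonneg (binInd_nonneg _ _ _)]
    by_cases ht : bin m (x t) = k
    · refine mul_le_mul_of_nonneg_left ?_ (binInd_nonneg _ _ _)
      exact (hf.1 _ _).trans (Real.rpow_le_rpow (abs_nonneg _)
        (abs_sub_le_of_bin_eq hm (ht.trans hk)) hγ.le)
    · simp [binInd, ht]
  have e : f z - binMean m k x y = ((f z - 1 / 2) - V - W) / (1 + N) := by
    have e1 : ∑ t, binInd m k (x t) * bernDensity 1 (y t) = V + W + N * f z := by
      rw [hV, hW, hN, binNoise, binCount, Finset.sum_mul, ← Finset.sum_add_distrib,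
        ← Finset.sum_add_distrib]
      exact Finset.sum_congr rfl fun t _ => by ring
    rw [binMean, e1, ← hN]
    have : 1 + N ≠ 0 := by positivity
    field_simp
    ring
  have hW2 : W ^ 2 ≤ (1 + N) ^ 2 * h ^ 2 := by
    rw [← sq_abs, ← mul_pow]
    exact pow_le_pow_left₀ (abs_nonneg _) (hWabs.trans (by nlinarith)) 2
  have hg : (f z - 1 / 2) ^ 2 ≤ 1 := by
    obtain ⟨h1, h2⟩ := hfz
    nlinarith
  rw [e, binError, ← hN, ← hV, ← hh, div_pow, div_le_iff₀ (by positivity)]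
  have e2 : 3 * (h ^ 2 + (1 + V ^ 2) / (1 + N) ^ 2) * (1 + N) ^ 2 =
      3 * ((1 + N) ^ 2 * h ^ 2 + (1 + V ^ 2)) := by
    have : 1 + N ≠ 0 := by positivity
    field_simp
  rw [e2]
  nlinarith [sq_nonneg ((f z - 1 / 2) + V), sq_nonneg ((f z - 1 / 2) + W), sq_nonneg (V - W)]

lemma integral_comp_bin (μ : Measure Covariate) [IsProbabilityMeasure μ] (m : ℕ) (Ψ : ℕ → ℝ) :
    ∫ z, Ψ (bin m z) ∂μ = ∑ k ∈ Finset.range (m + 1), Ψ k * ∫ z, binInd m k z ∂μ := by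
  have e : ∀ z, Ψ (bin m z) = ∑ k ∈ Finset.range (m + 1), Ψ k * binInd m k z := by
    intro z
    rw [Finset.sum_eq_single_of_mem (bin m z) (Finset.mem_range.2 (bin_lt m z))]
    · simp [binInd]
    · intro k _ hk
      simp [binInd, hk.symm]
  simp_rw [e]
  rw [integral_finsetSum]
  · simp_rw [integral_const_mul]
  · intro k _
    refine Integrable.const_mul ?_ _
    exact Integrable.of_bound (measurable_binInd m k).aestronglyMeasurable 1
      (Eventually.of_forall fun z => by
        rw [Real.norm_eq_abs, abs_of_nonneg (binInd_nonneg _ _ _)]; exact binInd_le_one _ _ _)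

lemma integrable_comp_bin (μ : Measure Covariate) [IsProbabilityMeasure μ] (m : ℕ) (Ψ : ℕ → ℝ) :
    Integrable (fun z => Ψ (bin m z)) μ := by
  refine Integrable.of_bound
    ((measurable_of_countable Ψ).comp (measurable_bin m)).aestronglyMeasurable
    (∑ k ∈ Finset.range (m + 1), |Ψ k|) (Eventually.of_forall fun z => ?_)
  rw [Real.norm_eq_abs]
  exact Finset.single_le_sum (f := fun k => |Ψ k|) (fun k _ => abs_nonneg _)
    (Finset.mem_range.2 (bin_lt m z))

lemma integrable_binInd (μ : Measure Covariate) [IsProbabilityMeasure μ] (m k : ℕ) :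
    Integrable (binInd m k) μ :=
  integrable_comp_bin μ m fun j => if j = k then 1 else 0

lemma klLoss_regressogram_le {γ : ℝ} (hγ : 0 < γ) {f : Covariate → ℝ} (hf : f ∈ offsetClass γ)
    {m : ℕ} (hm : 0 < m) (μ : Measure Covariate) [IsProbabilityMeasure μ]
    (x : Fin n → Covariate) (y : Fin n → Bool) :
    klLoss μ f (regressogram m x y) ≤ ENNReal.ofReal
      (∑ k ∈ Finset.range (m + 1), 5 * binError γ f m k x y * ∫ z, binInd m k z ∂μ) := by
  rw [← integral_comp_bin μ m fun k => 5 * binError γ f m k x y,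
    ofReal_integral_eq_lintegral_ofReal (integrable_comp_bin μ m fun k => 5 * binError γ f m k x y)
      (Eventually.of_forall fun z => mul_nonneg (by norm_num) (binError_nonneg _ _ _ _ _ _))]
  refine lintegral_mono fun z => ?_
  have hz := mem_Icc_of_mem_offsetClass hγ hf z
  refine (klDiv_bern_le ⟨by linarith [hz.1], by linarith [hz.2]⟩
    (regressogram_mem_Icc m x y z)).trans (ENNReal.ofReal_le_ofReal ?_)
  exact mul_le_mul_of_nonneg_left (sq_regressogram_sub_le hγ hf hm x y z) (by norm_num)

lemma integral_binError_le {γ : ℝ} {f : Covariate → ℝ} (hf : ∀ z, f z ∈ Set.Icc (0 : ℝ) 1)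
    (m k : ℕ) (x : Fin n → Covariate) :
    ∫ y, binError γ f m k x y ∂(Measure.pi fun t => bern (f (x t))) ≤
      3 * (((1 / m : ℝ) ^ γ) ^ 2 + 1 / (1 + binCount m k x)) := by
  have hN0 := binCount_nonneg m k x
  have hV : ∫ y, binNoise f m k x y ^ 2 ∂(Measure.pi fun t => bern (f (x t))) ≤
      binCount m k x := by
    simp only [binNoise]
    rw [integral_sq_sum_bern_sub _ (fun t => f (x t)) fun t => hf _, binCount]
    refine Finset.sum_le_sum fun t _ => ?_
    rw [binInd_sq]
    refine mul_le_of_le_one_right (binInd_nonneg _ _ _) ?_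
    obtain ⟨h1, h2⟩ := hf (x t)
    nlinarith
  simp only [binError]
  rw [integral_const_mul, integral_add Integrable.of_finite Integrable.of_finite,
    integral_div, integral_add Integrable.of_finite Integrable.of_finite]
  simp only [integral_const, probReal_univ, one_smul]
  have h1 : (1 + ∫ y, binNoise f m k x y ^ 2 ∂(Measure.pi fun t => bern (f (x t)))) /
      (1 + binCount m k x) ^ 2 ≤ 1 / (1 + binCount m k x) := by
    rw [div_le_div_iff₀ (by positivity) (by positivity)]
    nlinarith
  linarith

lemma integral_sq_binCount_sub (μ : Measure Covariate) [IsProbabilityMeasure μ] (m k : ℕ) :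
    ∫ x, (binCount (n := n) m k x - n * ∫ z, binInd m k z ∂μ) ^ 2 ∂(Measure.pi fun _ => μ) ≤
      n * ∫ z, binInd m k z ∂μ := by
  set w := ∫ z, binInd m k z ∂μ with hw
  have hi := integrable_binInd μ m k
  have e : ∀ x : Fin n → Covariate, binCount m k x - n * w = ∑ t, (binInd m k (x t) - w) := by
    intro x; simp [binCount]
  simp_rw [e]
  rw [integral_sq_sum_pi (μ := fun _ : Fin n => μ) (X := fun _ z => binInd m k z - w)]
  · have e2 : ∫ z, (binInd m k z - w) ^ 2 ∂μ = w - w ^ 2 := by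
      have : ∀ z, (binInd m k z - w) ^ 2 = binInd m k z - 2 * w * binInd m k z + w ^ 2 := by
        intro z
        linear_combination binInd_sq m k z
      simp_rw [this]
      have hi' : Integrable (fun z => binInd m k z - 2 * w * binInd m k z) μ :=
        hi.sub (hi.const_mul _)
      rw [integral_add hi' (integrable_const _),
        integral_sub hi (hi.const_mul _), integral_const_mul, ← hw]
      simp only [integral_const, probReal_univ, one_smul]
      ring
    rw [e2]
    simp only [Finset.sum_const, Finset.card_univ, Fintype.card_fin, nsmul_eq_mul]
    exact mul_le_mul_of_nonneg_left (by nlinarith [sq_nonneg w]) (by positivity)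
  · intro t
    refine MemLp.of_bound ((measurable_binInd m k).sub_const w).aestronglyMeasurable (1 + |w|)
      (Eventually.of_forall fun z => ?_)
    refine (norm_sub_le _ _).trans ?_
    rw [Real.norm_eq_abs, Real.norm_eq_abs, abs_of_nonneg (binInd_nonneg _ _ _)]
    linarith [binInd_le_one m k z]
  · intro t
    rw [integral_sub hi (integrable_const _), ← hw]
    simp

lemma integrable_inv_binCount (μ : Measure Covariate) [IsProbabilityMeasure μ] (m k : ℕ) :
    Integrable (fun x : Fin n → Covariate => 1 / (1 + binCount m k x)) (Measure.pi fun _ => μ) := by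
  refine Integrable.of_bound (measurable_const.div
    (measurable_const.add (measurable_binCount m k))).aestronglyMeasurable 1
    (Eventually.of_forall fun x => ?_)
  have := binCount_nonneg m k x
  rw [Real.norm_eq_abs, abs_of_nonneg (by positivity), div_le_one (by positivity)]
  linarith

lemma integral_inv_binCount_mul_le (hn : 0 < n) (μ : Measure Covariate) [IsProbabilityMeasure μ]
    (m k : ℕ) :
    (∫ x, 1 / (1 + binCount (n := n) m k x) ∂(Measure.pi fun _ => μ)) * ∫ z, binInd m k z ∂μ ≤
      6 / n := by
  have hn0 : (0 : ℝ) < n := by exact_mod_cast hn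
  have hvar := integral_sq_binCount_sub (n := n) μ m k
  set w := ∫ z, binInd m k z ∂μ with hw
  have hw0 : 0 ≤ w := integral_nonneg fun z => binInd_nonneg m k z
  rcases hw0.eq_or_lt with h0 | hw0
  · rw [← h0, mul_zero]; positivity
  set a := n * w with ha
  have ha0 : 0 < a := by positivity
  have hpt : ∀ x : Fin n → Covariate,
      1 / (1 + binCount m k x) ≤ 2 / a + 4 / a ^ 2 * (binCount m k x - a) ^ 2 := by
    intro x
    have hN := binCount_nonneg m k x
    rcases le_total (a / 2) (binCount m k x) with h | h
    · have h1 : 1 / (1 + binCount m k x) ≤ 2 / a := by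
        rw [div_le_div_iff₀ (by positivity) ha0]; linarith
      have : 0 ≤ 4 / a ^ 2 * (binCount m k x - a) ^ 2 := by positivity
      linarith
    · have h1 : 1 / (1 + binCount m k x) ≤ 1 := by
        rw [div_le_one (by positivity)]; linarith
      have h2 : 1 ≤ 4 / a ^ 2 * (binCount m k x - a) ^ 2 := by
        rw [div_mul_eq_mul_div, le_div_iff₀ (by positivity)]
        nlinarith
      have : 0 ≤ 2 / a := by positivity
      linarith
  have h_int : Integrable (fun x : Fin n → Covariate => (binCount m k x - a) ^ 2)
      (Measure.pi fun _ => μ) := by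
    refine Integrable.of_bound
      (((measurable_binCount m k).sub_const a).pow_const 2).aestronglyMeasurable ((n + a) ^ 2)
      (Eventually.of_forall fun x => ?_)
    have h1 := binCount_nonneg m k x
    have h2 : binCount m k x ≤ n := by
      have := Finset.sum_le_sum fun t (_ : t ∈ Finset.univ) => binInd_le_one m k (x t)
      simpa [binCount] using this
    rw [Real.norm_eq_abs, abs_of_nonneg (sq_nonneg _)]
    refine sq_le_sq' ?_ ?_ <;> linarith
  have h : ∫ x, 1 / (1 + binCount (n := n) m k x) ∂(Measure.pi fun _ => μ) ≤
      2 / a + 4 / a ^ 2 * a := by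
    refine (integral_mono (integrable_inv_binCount μ m k)
      ((integrable_const (2 / a)).add (h_int.const_mul (4 / a ^ 2))) hpt).trans ?_
    simp only [Pi.add_apply]
    rw [integral_add (integrable_const _) (h_int.const_mul _), integral_const_mul]
    simp only [integral_const, probReal_univ, one_smul]
    have := mul_le_mul_of_nonneg_left hvar (show 0 ≤ 4 / a ^ 2 by positivity)
    linarith
  refine (mul_le_mul_of_nonneg_right h hw0.le).trans (le_of_eq ?_)
  rw [ha]
  field_simp
  norm_num

lemma klRisk_regressogram_le {γ : ℝ} (hγ : 0 < γ) {f : Covariate → ℝ} (hf : f ∈ offsetClass γ)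
    {m : ℕ} (hm : 0 < m) (hn : 0 < n) (μ : Measure Covariate) [IsProbabilityMeasure μ] :
    klRisk (n := n) (regressogram m) μ f ≤
      ENNReal.ofReal (15 * (((1 / m : ℝ) ^ γ) ^ 2 + (m + 1) * (6 / n))) := by
  have hf01 : ∀ z, f z ∈ Set.Icc (0 : ℝ) 1 := fun z => by
    have := mem_Icc_of_mem_offsetClass hγ hf z
    exact ⟨by linarith [this.1], by linarith [this.2]⟩
  set w : ℕ → ℝ := fun k => ∫ z, binInd m k z ∂μ with hw
  have hw0 : ∀ k, 0 ≤ w k := fun k => integral_nonneg fun z => binInd_nonneg m k z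
  have hw1 : ∑ k ∈ Finset.range (m + 1), w k = 1 := by
    have := integral_comp_bin μ m fun _ => 1
    simpa using this.symm
  set h : ℝ := (1 / m : ℝ) ^ γ with hh
  have hy : ∀ x : Fin n → Covariate,
      ∫⁻ y, klLoss μ f (regressogram m x y) ∂(Measure.pi fun t => bern (f (x t))) ≤
        ENNReal.ofReal
          (∑ k ∈ Finset.range (m + 1), 15 * (h ^ 2 + 1 / (1 + binCount m k x)) * w k) := by
    intro x
    refine (lintegral_mono fun y => klLoss_regressogram_le hγ hf hm μ x y).trans ?_
    rw [← ofReal_integral_eq_lintegral_ofReal Integrable.of_finite (Eventually.of_forall fun y =>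
      Finset.sum_nonneg fun k _ =>
        mul_nonneg (mul_nonneg (by norm_num) (binError_nonneg _ _ _ _ _ _)) (hw0 k))]
    refine ENNReal.ofReal_le_ofReal ?_
    rw [integral_finsetSum _ fun k _ => Integrable.of_finite]
    refine Finset.sum_le_sum fun k _ => ?_
    rw [integral_mul_const, integral_const_mul]
    refine mul_le_mul_of_nonneg_right ?_ (hw0 k)
    have := integral_binError_le (γ := γ) hf01 m k x
    linarith
  refine (lintegral_mono hy).trans ?_
  have h_int : ∀ k, Integrable (fun x : Fin n → Covariate =>
      15 * (h ^ 2 + 1 / (1 + binCount m k x)) * w k) (Measure.pi fun _ => μ) := fun k =>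
    (((integrable_const _).add (integrable_inv_binCount μ m k)).const_mul 15).mul_const _
  rw [← ofReal_integral_eq_lintegral_ofReal (integrable_finsetSum _ fun k _ => h_int k)
    (Eventually.of_forall fun x => Finset.sum_nonneg fun k _ => mul_nonneg (by
      have := binCount_nonneg m k x
      positivity) (hw0 k))]
  refine ENNReal.ofReal_le_ofReal ?_
  rw [integral_finsetSum _ fun k _ => h_int k]
  have hk : ∀ k ∈ Finset.range (m + 1), ∫ x : Fin n → Covariate,
      15 * (h ^ 2 + 1 / (1 + binCount m k x)) * w k ∂(Measure.pi fun _ => μ) ≤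
      15 * h ^ 2 * w k + 15 * (6 / n) := by
    intro k _
    rw [integral_mul_const, integral_const_mul, integral_add (integrable_const _)
      (integrable_inv_binCount μ m k)]
    simp only [integral_const, probReal_univ, one_smul]
    have := integral_inv_binCount_mul_le hn μ m k
    simp only [hw]
    linarith
  refine (Finset.sum_le_sum hk).trans (le_of_eq ?_)
  rw [Finset.sum_add_distrib, ← Finset.mul_sum, hw1]
  simp
  ring

/-- The minimax risk of the class is at most of order `n^{-2γ/(2γ+1)}`. -/
lemma minimaxRisk_offsetClass_le {γ : ℝ} (hγ : 0 < γ) (hn : 1 ≤ n) :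
    minimaxRisk (offsetClass γ) n ≤
      ENNReal.ofReal (285 * (n : ℝ) ^ (-(2 * γ / (2 * γ + 1)))) := by
  have hn1 : (1 : ℝ) ≤ n := by exact_mod_cast hn
  have hn0 : (0 : ℝ) < n := by linarith
  set M : ℝ := (n : ℝ) ^ (1 / (2 * γ + 1)) with hM
  have hM1 : 1 ≤ M := Real.one_le_rpow hn1 (by positivity)
  set m : ℕ := ⌈M⌉₊ with hm
  have hmM : M ≤ m := Nat.le_ceil M
  have hmM2 : (m : ℝ) < M + 1 := Nat.ceil_lt_add_one (by linarith)
  have hm0 : 0 < m := Nat.ceil_pos.2 (by linarith)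
  have hm0' : (0 : ℝ) < m := by exact_mod_cast hm0
  refine (iInf₂_le (regressogram m) (isEstimator_regressogram m)).trans ?_
  refine iSup₂_le fun μ hμ => iSup₂_le fun f hf => ?_
  refine (klRisk_regressogram_le hγ hf hm0 hn μ).trans (ENNReal.ofReal_le_ofReal ?_)
  set R : ℝ := (n : ℝ) ^ (-(2 * γ / (2 * γ + 1))) with hR
  have h1 : ((1 / m : ℝ) ^ γ) ^ 2 ≤ R := by
    have e : R = ((1 / M) ^ γ) ^ 2 := by
      rw [one_div, hM, ← Real.rpow_neg hn0.le, ← Real.rpow_mul hn0.le,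
        ← Real.rpow_mul_natCast hn0.le, hR]
      congr 1
      push_cast
      field_simp
    rw [e]
    have := one_div_le_one_div_of_le (by linarith) hmM
    gcongr
  have h2 : M / n = R := by
    rw [hM, hR, ← Real.rpow_sub_one hn0.ne']
    congr 1
    field_simp
    ring
  have h3 : ((m : ℝ) + 1) * (6 / n) ≤ 18 * R := by
    rw [← h2]
    calc ((m : ℝ) + 1) * (6 / n) ≤ (3 * M) * (6 / n) :=
          mul_le_mul_of_nonneg_right (by linarith) (by positivity)
      _ = 18 * (M / n) := by ring
  linarith

end Regressogram

/-! ### The lower bounds for the maximum likelihood estimate -/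

lemma one_le_log_of_three_le {n : ℕ} (hn : 3 ≤ n) : 1 ≤ Real.log n := by
  rw [Real.le_log_iff_exp_le (by positivity)]
  have : (3 : ℝ) ≤ n := by exact_mod_cast hn
  linarith [Real.exp_one_lt_d9]

lemma exists_le_liminf_innerProb {γ : ℝ} (hγ : 0 < γ) (hγ1 : γ < 1) {δ : ℝ} (hδ : 0 < δ) :
    ∃ C : ℝ, 0 < C ∧ ENNReal.ofReal (1 - δ) ≤
      liminf (fun n : ℕ => innerProb (fairLaw n) {s | ∀ f, IsMLE (offsetClass γ) s.1 s.2 f →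
        C * ((n : ℝ) * Real.log n) ^ (-γ) ≤ hellingerLoss f}) atTop := by
  obtain ⟨η, hη, hev⟩ := exists_eventually_le_offset hγ hγ1 hδ
  refine ⟨η ^ 2 / 16, by positivity, le_liminf_of_le (by isBoundedDefault) ?_⟩
  filter_upwards [hev, eventually_ge_atTop 3] with n hG hn
  obtain ⟨G, -, hGp, hG⟩ := hG
  have hn0 : (0 : ℝ) < n := by positivity
  rw [innerProb, ENNReal.ofReal_sub _ hδ.le, ENNReal.ofReal_one]
  refine tsub_le_tsub_left ((measure_mono (Set.compl_subset_compl.2 ?_)).trans hGp) 1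
  intro s hs f hf
  have hoff := hG s hs f hf
  refine le_trans ?_ (le_hellingerLoss hγ hf.1)
  have hp : 0 < (n : ℝ) ^ (γ / 2) := Real.rpow_pos_of_pos hn0 _
  have h1 : ((n : ℝ) * Real.log n) ^ (-γ) ≤ (n : ℝ) ^ (-γ) :=
    Real.rpow_le_rpow_of_nonpos hn0
      (le_mul_of_one_le_right hn0.le (one_le_log_of_three_le hn)) (by linarith)
  have h2 : (η / (n : ℝ) ^ (γ / 2)) ^ 2 ≤ (f origin - 1 / 2) ^ 2 :=
    pow_le_pow_left₀ (by positivity) hoff 2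
  rw [div_pow, ← rpow_eq_sq hn0, div_eq_mul_inv, ← Real.rpow_neg hn0.le] at h2
  have h3 := mul_le_mul_of_nonneg_left h1 (sq_nonneg η)
  linarith

lemma exists_eventually_le_klRisk {γ : ℝ} (hγ : 0 < γ) (hγ1 : γ < 1)
    (mle : (n : ℕ) → (Fin n → Covariate) → (Fin n → Bool) → Covariate → ℝ)
    (hmle : ∀ n x y, IsMLE (offsetClass γ) x y (mle n x y)) :
    ∃ c : ℝ, 0 < c ∧ ∀ᶠ n : ℕ in atTop,
      ENNReal.ofReal (c * (n : ℝ) ^ (-γ)) ≤ klRisk (mle n) unif (fun _ => 1 / 2) := by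
  obtain ⟨η, hη, hev⟩ := exists_eventually_le_offset hγ hγ1 (ε := 1 / 2) (by norm_num)
  refine ⟨η ^ 2 / 4, by positivity, ?_⟩
  filter_upwards [hev, eventually_gt_atTop 0] with n hG hn
  obtain ⟨G, hGm, hGp, hG⟩ := hG
  have hn0 : (0 : ℝ) < n := by exact_mod_cast hn
  have hp : 0 < (n : ℝ) ^ (γ / 2) := Real.rpow_pos_of_pos hn0 _
  set v : ℝ := η ^ 2 * (n : ℝ) ^ (-γ) / 2 with hv
  have hloss : ∀ s : (Fin n → Covariate) × (Fin n → Bool),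
      G.indicator (fun _ => ENNReal.ofReal v) s ≤
        klLoss unif (fun _ => 1 / 2) (mle n s.1 s.2) := by
    intro s
    refine Set.indicator_apply_le' (fun hs => ?_) (fun _ => zero_le)
    refine le_trans (ENNReal.ofReal_le_ofReal ?_) (le_klLoss_half hγ (hmle n s.1 s.2).1)
    have h2 : (η / (n : ℝ) ^ (γ / 2)) ^ 2 ≤ (mle n s.1 s.2 origin - 1 / 2) ^ 2 :=
      pow_le_pow_left₀ (by positivity) (hG s hs _ (hmle n s.1 s.2)) 2
    rw [div_pow, ← rpow_eq_sq hn0, div_eq_mul_inv, ← Real.rpow_neg hn0.le] at h2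
    linarith
  have hprob : IsProbabilityMeasure (fairLaw n) := by unfold fairLaw; infer_instance
  have hGhalf : ENNReal.ofReal (1 / 2) ≤ fairLaw n G := by
    have h1 : (1 : ℝ≥0∞) ≤ fairLaw n G + ENNReal.ofReal (1 / 2) := by
      rw [← prob_add_prob_compl (μ := fairLaw n) hGm]
      gcongr
    have h2 : ENNReal.ofReal (1 / 2) = 1 - ENNReal.ofReal (1 / 2) := by
      rw [← ENNReal.ofReal_one, ← ENNReal.ofReal_sub _ (by norm_num)]
      norm_num
    rw [h2]
    exact tsub_le_iff_right.2 h1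
  calc ENNReal.ofReal (η ^ 2 / 4 * (n : ℝ) ^ (-γ))
      = ENNReal.ofReal v * ENNReal.ofReal (1 / 2) := by
        rw [← ENNReal.ofReal_mul (by positivity)]; congr 1; rw [hv]; ring
    _ ≤ ENNReal.ofReal v * fairLaw n G := by gcongr
    _ = ∫⁻ s, G.indicator (fun _ => ENNReal.ofReal v) s ∂(fairLaw n) := by
        rw [lintegral_indicator_const hGm]
    _ = ∫⁻ x, ∫⁻ y, G.indicator (fun _ => ENNReal.ofReal v) (x, y)
          ∂(Measure.pi fun _ => bern (1 / 2)) ∂(Measure.pi fun _ => unif) := by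
        rw [fairLaw, lintegral_prod _ (measurable_const.indicator hGm).aemeasurable]
    _ ≤ klRisk (mle n) unif (fun _ => 1 / 2) :=
        lintegral_mono fun x => lintegral_mono fun y => hloss (x, y)

lemma eventually_mul_rpow_lt {γ : ℝ} (hγ : 0 < γ) (hγ2 : γ < 1 / 2) {c : ℝ} (hc : 0 < c) (L : ℝ) :
    ∀ᶠ n : ℕ in atTop,
      L * (n : ℝ) ^ (-(2 * γ / (2 * γ + 1))) < c * (n : ℝ) ^ (-γ) := by
  have hpos : 0 < 2 * γ / (2 * γ + 1) - γ := by
    rw [sub_pos, lt_div_iff₀ (by linarith)]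
    nlinarith
  have h := ((tendsto_rpow_atTop hpos).comp
    tendsto_natCast_atTop_atTop).eventually_gt_atTop (L / c)
  filter_upwards [h, eventually_gt_atTop 0] with n hL hn
  have hn0 : (0 : ℝ) < n := by exact_mod_cast hn
  have e : (n : ℝ) ^ (-γ) =
      (n : ℝ) ^ (2 * γ / (2 * γ + 1) - γ) * (n : ℝ) ^ (-(2 * γ / (2 * γ + 1))) := by
    rw [← Real.rpow_add hn0]; congr 1; ring
  rw [e, ← mul_assoc]
  refine mul_lt_mul_of_pos_right ?_ (Real.rpow_pos_of_pos hn0 _)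
  have hL' : L / c < (n : ℝ) ^ (2 * γ / (2 * γ + 1) - γ) := hL
  rw [div_lt_iff₀ hc] at hL'
  linarith

lemma eventually_mul_minimaxRisk_lt {γ : ℝ} (hγ : 0 < γ) (hγ2 : γ < 1 / 2)
    (mle : (n : ℕ) → (Fin n → Covariate) → (Fin n → Bool) → Covariate → ℝ)
    (hmle : ∀ n x y, IsMLE (offsetClass γ) x y (mle n x y)) (M : NNReal) :
    ∀ᶠ n : ℕ in atTop, (M : ℝ≥0∞) * minimaxRisk (offsetClass γ) n <
      klRisk (mle n) unif (fun _ => 1 / 2) := by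
  obtain ⟨c, hc, hev⟩ := exists_eventually_le_klRisk hγ (by linarith) mle hmle
  filter_upwards [hev, eventually_mul_rpow_lt hγ hγ2 hc (M * 285), eventually_gt_atTop 0]
    with n h1 h2 hn
  have hn0 : (0 : ℝ) < n := by exact_mod_cast hn
  refine lt_of_lt_of_le ?_ h1
  calc (M : ℝ≥0∞) * minimaxRisk (offsetClass γ) n
      ≤ M * ENNReal.ofReal (285 * (n : ℝ) ^ (-(2 * γ / (2 * γ + 1)))) := by
        gcongr
        exact minimaxRisk_offsetClass_le hγ hn
    _ = ENNReal.ofReal (M * 285 * (n : ℝ) ^ (-(2 * γ / (2 * γ + 1)))) := by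
        rw [mul_assoc, ENNReal.ofReal_mul (p := (M : ℝ)) M.2, ENNReal.ofReal_coe_nnreal]
    _ < ENNReal.ofReal (c * (n : ℝ) ^ (-γ)) :=
        (ENNReal.ofReal_lt_ofReal_iff (mul_pos hc (Real.rpow_pos_of_pos hn0 _))).2 h2

end CondDensity

end

theorem theorem6 (γ : ℝ) (hγ : γ ∈ Set.Ioo (0 : ℝ) (1 / 2)) :
    ∃ F : Set (CondDensity.Covariate → ℝ),
      -- a convex class of `γ`-Hölder maps into `[7/16, 9/16]`, containing the truth `1/2`
      Convex ℝ F ∧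
      (∀ f ∈ F, HolderWith 1 γ.toNNReal f ∧ ∀ x, f x ∈ Set.Icc (7 / 16 : ℝ) (9 / 16)) ∧
      (fun _ => (1 / 2 : ℝ)) ∈ F ∧
      -- a maximum likelihood estimate exists on every sample
      (∀ (n : ℕ) (x : Fin n → CondDensity.Covariate) (y : Fin n → Bool),
        ∃ f, CondDensity.IsMLE F x y f) ∧
      -- lower bound on the Hellinger loss, simultaneously for all maximum likelihood estimates
      (∀ δ : ℝ, 0 < δ → ∃ C : ℝ, 0 < C ∧
        ENNReal.ofReal (1 - δ) ≤
          liminf (fun n : ℕ => CondDensity.innerProb (CondDensity.fairLaw n)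
            {s | ∀ f, CondDensity.IsMLE F s.1 s.2 f →
              C * ((n : ℝ) * Real.log n) ^ (-γ) ≤ CondDensity.hellingerLoss f}) atTop) ∧
      -- the minimax risk is at most of order `n^{-2γ/(2γ+1)}`
      (∃ K : ℝ, 0 < K ∧ ∀ n : ℕ, 1 ≤ n →
        CondDensity.minimaxRisk F n ≤
          ENNReal.ofReal (K * (n : ℝ) ^ (-(2 * γ / (2 * γ + 1))))) ∧
      -- no maximum likelihood estimator attains the order of the minimax risk
      (∀ mle : (n : ℕ) → (Fin n → CondDensity.Covariate) → (Fin n → Bool) →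
          CondDensity.Covariate → ℝ,
        (∀ n x y, CondDensity.IsMLE F x y (mle n x y)) →
        ∀ M : NNReal, ∀ᶠ n : ℕ in atTop,
          (M : ℝ≥0∞) * CondDensity.minimaxRisk F n <
            CondDensity.klRisk (mle n) CondDensity.unif (fun _ => 1 / 2)) := by
  obtain ⟨hγ0, hγ2⟩ := hγ
  exact ⟨CondDensity.offsetClass γ, CondDensity.convex_offsetClass γ,
    fun f hf => ⟨CondDensity.holderWith_of_mem_offsetClass hγ0 hf,
      CondDensity.mem_Icc_of_mem_offsetClass hγ0 hf⟩,
    CondDensity.half_mem_offsetClass γ,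
    fun n x y => CondDensity.exists_isMLE hγ0 x y,
    fun δ hδ => CondDensity.exists_le_liminf_innerProb hγ0 (by linarith) hδ,
    ⟨285, by norm_num, fun n hn => CondDensity.minimaxRisk_offsetClass_le hγ0 hn⟩,
    fun mle hmle M => CondDensity.eventually_mul_minimaxRisk_lt hγ0 hγ2 mle hmle M⟩
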